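/- Let $d\ge 1$, $\mathcal X=[0,1]^d$, and let $(\varphi_k)_{k\ge1}$ be an orthonormal basis of $L^2(\mathcal X)$ (Lebesgue measure); write $f_k=\langle f,\varphi_k\rangle$ and, for $\beta,L>0$, $\mathcal S^\beta(L)=\{f:\ \sum_{k\ge1}k^{2\beta}f_k^2\le L^2\}$. Let $H$ be a probability law on $\mathbb R$ with density $h$ that is symmetric, positive, bounded and decreasing on $[0,\infty)$, and suppose that for some $c_1,c_2>0$ and $\kappa\ge0$ $$\log(1/h(x))\le c_1\bigl(1+\log^{1+\kappa}(1+x)\bigr)\quad(x\ge0),\qquad \int_x^\infty h(u)\,du\le c_2/x^2\quad(x\ge1).$$ Let the prior $\Pi$ on $f=\sum_k f_k\varphi_k$ be given by $f_k=\sigma_k\zeta_k$ with $\zeta_k$ i.i.d. of law $H$. Binary classification model: one observes i.i.d. $(X_1,Y_1),\dots,(X_n,Y_n)$ in $\mathcal X\times\{0,1\}$, where $X$ has law $G$ with a bounded Lebesgue density $g$, and, given $f$, $P(Y=1\mid X=x)=h_f(x)=\Lambda(f(x))$ with $\Lambda(u)=1/(1+e^{-u})$. The density of one observation is $p_f(x,y)=h_f(x)^y(1-h_f(x))^{1-y}g(x)$,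 and $$\|p_f-p_{f_0}\|_{G,1}=\sum_{y\in\{0,1\}}\int\bigl|h_f(x)^y(1-h_f(x))^{1-y}-h_{f_0}(x)^y(1-h_{f_0}(x))^{1-y}\bigr|\,dG(x)$$ is the $L^1$-distance between the densities $p_f$ and $p_{f_0}$. For $0<\rho<1$ the $\rho$-posterior is $$\Pi_\rho[B\mid X_1,Y_1,\dots,X_n,Y_n]=\frac{\int_B\prod_{i\le n}p_f(X_i,Y_i)^\rho\,d\Pi(f)}{\int\prod_{i\le n}p_f(X_i,Y_i)^\rho\,d\Pi(f)}.$$ Suppose that the data are generated from $P_0=P_{f_0}$, with true logit $f_0\in\mathcal S^\beta(L)$ for some $\beta,L>0$, and that one of the following holds: (i) $\sigma_k=k^{-1/2-\alpha}$ with $\alpha>1/2$ and $\beta\le\alpha$, and $\varepsilon_n=(\log n)^{\frac{1+(1+\kappa)\beta}{2\beta+1}}\,n^{-\frac{\beta}{2\beta+1}}$; (ii) $\sigma_k=e^{-a(\log k)^{1+\delta}}$ with $a,\delta>0$, and $\varepsilon_n=(\log n)^{\frac{(1+\kappa)(1+\delta)\beta}{2\beta+1}}\,n^{-\frac{\beta}{2\beta+1}}$.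 Then for every $\rho\in(0,1)$ there exists $M>0$ such that, as $n\to\infty$, $$E_{P_0}\,\Pi_\rho\bigl[\|p_f-p_{f_0}\|_{G,1}>M\varepsilon_n\,\big|\,X_1,Y_1,\dots,X_n,Y_n\bigr]\to0.$$ -/

import Mathlib

open MeasureTheory Filter Topology

noncomputable section

/-- The covariate space `[0,1]^d`; its `volume` is Lebesgue measure (a probability measure). -/
abbrev Cube (d : ℕ) : Type := Fin d → unitInterval

/-- Real `L²([0,1]^d)`, with respect to Lebesgue measure. -/
abbrev L2Cube (d : ℕ) : Type := Lp ℝ 2 (volume : Measure (Cube d))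

/-- `H` is a heavy-tailed law with density `h` and constants `c₁, κ, c₂`. -/
structure IsHeavyTailed (H : Measure ℝ) (h : ℝ → ℝ) (c₁ κ c₂ : ℝ) : Prop where
  hasDensity : H = volume.withDensity (fun x => ENNReal.ofReal (h x))
  integrable : Integrable h
  symmetric : ∀ x, h (-x) = h x
  positive : ∀ x, 0 < h x
  bounded : ∃ B, ∀ x, h x ≤ B
  decreasing : AntitoneOn h (Set.Ici 0)
  log_inv_le : ∀ x, 0 ≤ x → Real.log (1 / h x) ≤ c₁ * (1 + Real.log (1 + x) ^ (1 + κ))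
  tail_le : ∀ x, 1 ≤ x → ∫ u in Set.Ioi x, h u ≤ c₂ / x ^ 2

/-- `σ_k = k^{-1/2-α}`, `k ≥ 1`. The entry number `k` of a sequence on `ℕ` stands for the
index `k + 1`, here and for the basis and coefficients below. -/
def polyScale (α : ℝ) (k : ℕ) : ℝ := ((k : ℝ) + 1) ^ (-(1 / 2) - α)

/-- `σ_k = exp(-a (log k)^{1+δ})`, `k ≥ 1`. -/
def fastScale (a δ : ℝ) (k : ℕ) : ℝ := Real.exp (-a * Real.log ((k : ℝ) + 1) ^ (1 + δ))

/-- The rate attached to `polyScale`. -/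
def polyRate (κ β : ℝ) (n : ℕ) : ℝ :=
  Real.log n ^ ((1 + (1 + κ) * β) / (2 * β + 1)) * (n : ℝ) ^ (-(β / (2 * β + 1)))

/-- The rate attached to `fastScale`. -/
def fastRate (κ δ β : ℝ) (n : ℕ) : ℝ :=
  Real.log n ^ (((1 + κ) * (1 + δ) * β) / (2 * β + 1)) * (n : ℝ) ^ (-(β / (2 * β + 1)))

/-- The Sobolev-type ball `{f : ∑_{k ≥ 1} k^{2β} ⟨f, φ_k⟩² ≤ L²}`. -/
def sobolevBall {d : ℕ} (φ : HilbertBasis ℕ ℝ (L2Cube d)) (β L : ℝ) : Set (L2Cube d) :=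
  {f | Summable (fun k : ℕ => ((k : ℝ) + 1) ^ (2 * β) * (inner ℝ f (φ k)) ^ 2) ∧
    ∑' k : ℕ, ((k : ℝ) + 1) ^ (2 * β) * (inner ℝ f (φ k)) ^ 2 ≤ L ^ 2}

/-- The prior on coefficient sequences: the law of `(σ_k ζ_k)_k` with `ζ_k` i.i.d. of law `H`. -/
def seriesPrior (σ : ℕ → ℝ) (H : Measure ℝ) [IsProbabilityMeasure H] : Measure (ℕ → ℝ) :=
  (Measure.infinitePi (fun _ : ℕ => H)).map (fun ζ k => σ k * ζ k)

/-- The function `f = ∑_k θ_k φ_k` with coefficients `θ`, evaluated pointwise. Evaluating the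
series at points gives a version of the `L²` sum that is jointly measurable in `(θ, x)`. -/
def seriesFun {d : ℕ} (φ : HilbertBasis ℕ ℝ (L2Cube d)) (θ : ℕ → ℝ) (x : Cube d) : ℝ :=
  ∑' k : ℕ, θ k * φ k x

/-- `h_f(x)^y (1 - h_f(x))^{1-y}` with `h_f = Λ(f)`, `Λ(u) = 1 / (1 + e^{-u})`: the probability
of the label `y` given the covariate `x`. -/
def labelProb {d : ℕ} (f : Cube d → ℝ) (z : Cube d × Fin 2) : ℝ :=
  Real.sigmoid (f z.1) ^ (z.2 : ℕ) * (1 - Real.sigmoid (f z.1)) ^ (1 - (z.2 : ℕ))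

/-- The density `p_f(x, y) = h_f(x)^y (1 - h_f(x))^{1-y} g(x)` of one observation `(X, Y)`. -/
def obsDensity {d : ℕ} (g f : Cube d → ℝ) (z : Cube d × Fin 2) : ℝ :=
  labelProb f z * g z.1

/-- The law of one observation `(X, Y)` under `f`. -/
def obsLaw {d : ℕ} (g f : Cube d → ℝ) : Measure (Cube d × Fin 2) :=
  ((volume : Measure (Cube d)).prod Measure.count).withDensity
    (fun z => ENNReal.ofReal (obsDensity g f z))

/-- The marginal law `G` of the covariate, with Lebesgue density `g`. -/
def designLaw {d : ℕ} (g : Cube d → ℝ) : Measure (Cube d) :=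
  volume.withDensity (fun x => ENNReal.ofReal (g x))

/-- The distance `‖p_f - p_{f'}‖_{G,1}`: the `L¹` distance, with respect to `G` times counting
measure, of the label probabilities. As `g` factorises, this is the `L¹` distance of the
densities `p_f` and `p_{f'}` of one observation. -/
def distG1 {d : ℕ} (g f f' : Cube d → ℝ) : ℝ :=
  ∫ x, ∑ y : Fin 2, |labelProb f (x, y) - labelProb f' (x, y)| ∂(designLaw g)

/-- The tempered posterior `Π_ρ[B | z] = ∫_B p_θ(z)^ρ dΠ(θ) / ∫ p_θ(z)^ρ dΠ(θ)`. -/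
def temperedPosterior {Θ Z : Type*} [MeasurableSpace Θ] (prior : Measure Θ) (p : Θ → Z → ℝ)
    (ρ : ℝ) (z : Z) (B : Set Θ) : ENNReal :=
  (∫⁻ θ in B, ENNReal.ofReal (p θ z ^ ρ) ∂prior) / ∫⁻ θ, ENNReal.ofReal (p θ z ^ ρ) ∂prior

/-- `E_{P₀} Π_ρ[ ‖p_f - p_{f₀}‖_{G,1} > r | X₁, Y₁, …, Xₙ, Yₙ ]`, where the `n` observations are
i.i.d. under `f₀` and `f` has the series prior with scales `σ` and coefficient law `H`. -/
def expectedPosterior {d : ℕ} (φ : HilbertBasis ℕ ℝ (L2Cube d)) (σ : ℕ → ℝ) (H : Measure ℝ)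
    [IsProbabilityMeasure H] (g f₀ : Cube d → ℝ) (ρ : ℝ) (n : ℕ) (r : ℝ) : ENNReal :=
  ∫⁻ z : Fin n → Cube d × Fin 2,
    temperedPosterior (seriesPrior σ H)
      (fun θ (w : Fin n → Cube d × Fin 2) => ∏ i, obsDensity g (seriesFun φ θ) (w i)) ρ z
      {θ | distG1 g (seriesFun φ θ) f₀ > r}
    ∂(Measure.pi fun _ : Fin n => obsLaw g f₀)

end

open scoped ENNReal
open ProbabilityTheory

/-! ### Inequalities for the logistic function -/

/-! For `ρ < 1` no tests, sieves or entropy bounds are needed: contraction follows from a lower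
bound on the prior mass near the truth. Write `R` for the likelihood ratio against `f₀` raised to
the power `ρ`.

Numerator. By independence the mean of `R` under `P₀` is the `n`-th power of the affinity `∫ p_f^ρ
p_{f₀}^{1-ρ}`. A quantitative arithmetic-geometric mean inequality bounds this power by `exp(-n m
r²)`, `m = min ρ (1-ρ) / 8`, whenever the `L¹` distance exceeds `r` (`lintegral_temperedRatio_le`).
Fubini then bounds the expected numerator.

Denominator. The log-sigmoid is 1-Lipschitz and the Bernoulli divergence is at most the squared
logit difference, so a squared `L²(G)` distance at most `V` bounds both the divergence and the
second moment of the log-likelihood ratio by `V`. Chebyshev gives `R ≥ exp(-2ρnV)` except with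
probability `1/(nV)` (`measure_prod_temperedRatio_lt_le`). `lintegral_div_lintegral_le` joins the
two bounds.

Prior mass. Cut at `K ≈ r^{-1/β}`. Each of the first `K` coefficients must lie within `r/√K` of its
target. Since `log(1/h)` grows only polylogarithmically, even a target that is huge on the scale
`σ_k` costs only a power of `log n`; hence the prior adapts to every `β` allowed, without tuning.
The coefficients beyond `K` only have to stay moderate, at total cost `O(K)`
(`exists_seriesPrior_ge`). The rate balances `K (log n)^s` against `n r²` (`exists_cutoff`), where
`s = q(1+κ)` and `log(1/σ_k)` is of order at most `(log k)^q`: `q = 1` for polynomial scales and `q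
= 1+δ` for the fast ones. -/

lemma sigmoid_le_exp_mul_sigmoid (u w : ℝ) :
    Real.sigmoid u ≤ Real.exp |u - w| * Real.sigmoid w := by
  rw [Real.sigmoid_def, Real.sigmoid_def, ← div_eq_mul_inv, inv_eq_one_div,
    div_le_div_iff₀ (by positivity) (by positivity)]
  have h1 : 1 ≤ Real.exp |u - w| := Real.one_le_exp (abs_nonneg _)
  have h2 : Real.exp (-w) ≤ Real.exp |u - w| * Real.exp (-u) := by
    rw [← Real.exp_add]
    exact Real.exp_le_exp.2 (by linarith [le_abs_self (u - w)])
  linarith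

lemma abs_log_sigmoid_sub_le (u w : ℝ) :
    |Real.log (Real.sigmoid u) - Real.log (Real.sigmoid w)| ≤ |u - w| := by
  have key : ∀ u w : ℝ, Real.log (Real.sigmoid u) - Real.log (Real.sigmoid w) ≤ |u - w| := by
    intro u w
    have h := Real.log_le_log (Real.sigmoid_pos u) (sigmoid_le_exp_mul_sigmoid u w)
    rw [Real.log_mul (Real.exp_pos _).ne' (Real.sigmoid_pos w).ne', Real.log_exp] at h
    linarith
  rw [abs_le]
  have := key w u
  rw [abs_sub_comm] at this
  exact ⟨by linarith, key u w⟩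

/-- The multiplicative bound gives `σ(w) ≥ e^{-|u-w|} σ(u) ≥ (1 - |u-w|) σ(u)`, and `σ(u) ≤ 1`. -/
lemma abs_sigmoid_sub_le (u w : ℝ) : |Real.sigmoid u - Real.sigmoid w| ≤ |u - w| := by
  have key : ∀ u w : ℝ, Real.sigmoid u - Real.sigmoid w ≤ |u - w| := by
    intro u w
    have hu := Real.sigmoid_pos u
    have hu1 := Real.sigmoid_lt_one u
    have h := sigmoid_le_exp_mul_sigmoid u w
    have h3 : Real.exp (-|u - w|) * Real.sigmoid u ≤ Real.sigmoid w := by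
      calc Real.exp (-|u - w|) * Real.sigmoid u
          ≤ Real.exp (-|u - w|) * (Real.exp |u - w| * Real.sigmoid w) := by gcongr
        _ = Real.sigmoid w := by rw [← mul_assoc, ← Real.exp_add]; simp
    have h4 := Real.add_one_le_exp (-|u - w|)
    nlinarith [abs_nonneg (u - w)]
  rw [abs_le]
  have := key w u
  rw [abs_sub_comm] at this
  exact ⟨by linarith, key u w⟩

lemma log_sigmoid_neg (u : ℝ) :
    Real.log (Real.sigmoid (-u)) = Real.log (Real.sigmoid u) - u := by
  rw [← Real.sigmoid_mul_rexp_neg, Real.log_mul (Real.sigmoid_pos u).ne' (Real.exp_pos _).ne',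
    Real.log_exp]
  ring

/-- The Kullback–Leibler divergence of two Bernoulli laws is at most the squared distance of
their logits. -/
lemma bernoulli_kl_le (u w : ℝ) :
    Real.sigmoid u * (Real.log (Real.sigmoid u) - Real.log (Real.sigmoid w)) +
      Real.sigmoid (-u) * (Real.log (Real.sigmoid (-u)) - Real.log (Real.sigmoid (-w)))
      ≤ (u - w) ^ 2 := by
  have gibbs : ∀ u w : ℝ, Real.sigmoid w *
      (Real.log (Real.sigmoid u) - Real.log (Real.sigmoid w)) ≤
        Real.sigmoid u - Real.sigmoid w := by
    intro u w
    have hu := Real.sigmoid_pos u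
    have hw := Real.sigmoid_pos w
    rw [← Real.log_div hu.ne' hw.ne']
    calc _ ≤ Real.sigmoid w * (Real.sigmoid u / Real.sigmoid w - 1) := by
          gcongr
          exact Real.log_le_sub_one_of_pos (by positivity)
      _ = _ := by field_simp
  -- Adding `h1` and `h2` says that the reversed divergence is nonnegative. The two divergences sum
  -- exactly to `(σ(u) - σ(w))(u - w)`, which `h3` bounds.
  have h1 := gibbs u w
  have h2 := gibbs (-u) (-w)
  have h3 : (Real.sigmoid u - Real.sigmoid w) * (u - w) ≤ (u - w) ^ 2 := by
    calc _ ≤ |Real.sigmoid u - Real.sigmoid w| * |u - w| := by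
          rw [← abs_mul]; exact le_abs_self _
      _ ≤ |u - w| * |u - w| :=
          mul_le_mul_of_nonneg_right (abs_sigmoid_sub_le u w) (abs_nonneg _)
      _ = (u - w) ^ 2 := by rw [← sq, sq_abs]
  rw [log_sigmoid_neg, log_sigmoid_neg, Real.sigmoid_neg, Real.sigmoid_neg] at *
  nlinarith

/-- A refinement of the weighted arithmetic-geometric mean inequality on `[0,1]`. -/
lemma rpow_mul_rpow_le_sub_sq {ρ a b : ℝ} (h0 : 0 < ρ) (h1 : ρ < 1) (ha : 0 ≤ a) (hb : 0 ≤ b)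
    (ha1 : a ≤ 1) (hb1 : b ≤ 1) :
    a ^ ρ * b ^ (1 - ρ) ≤ ρ * a + (1 - ρ) * b - min ρ (1 - ρ) / 4 * (a - b) ^ 2 := by
  have half : ∀ ρ a b : ℝ, 0 < ρ → ρ ≤ 1 / 2 → 0 ≤ a → 0 ≤ b → a ≤ 1 → b ≤ 1 →
      a ^ ρ * b ^ (1 - ρ) ≤ ρ * a + (1 - ρ) * b - ρ / 4 * (a - b) ^ 2 := by
    intro ρ a b h0 h1 ha hb ha1 hb1
    set s := Real.sqrt a
    set t := Real.sqrt b
    have hs : 0 ≤ s := Real.sqrt_nonneg _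
    have ht : 0 ≤ t := Real.sqrt_nonneg _
    have hsa : s ^ 2 = a := Real.sq_sqrt ha
    have htb : t ^ 2 = b := Real.sq_sqrt hb
    have hs1 : s ≤ 1 := by rw [← Real.sqrt_one]; exact Real.sqrt_le_sqrt ha1
    have ht1 : t ≤ 1 := by rw [← Real.sqrt_one]; exact Real.sqrt_le_sqrt hb1
    -- Splitting off `√(ab)` leaves the ordinary weighted inequality with weights `2ρ` and `1 - 2ρ`;
    -- the gain is `ρ(√a - √b)²`, because `2√(ab) = a + b - (√a - √b)²`.
    have e : a ^ ρ * b ^ (1 - ρ) = (s * t) ^ (2 * ρ) * b ^ (1 - 2 * ρ) := by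
      rw [Real.mul_rpow hs ht, ← hsa, ← htb, ← Real.rpow_natCast, ← Real.rpow_natCast,
        ← Real.rpow_mul hs, ← Real.rpow_mul ht, ← Real.rpow_mul ht, mul_assoc,
        ← Real.rpow_add_of_nonneg ht (by positivity) (by push_cast; linarith)]
      congr 2
      push_cast
      ring
    have am := Real.geom_mean_le_arith_mean2_weighted (w₁ := 2 * ρ) (w₂ := 1 - 2 * ρ)
      (p₁ := s * t) (p₂ := b) (by positivity) (by linarith) (by positivity) hb (by ring)
    rw [e]
    have h4 : (a - b) ^ 2 ≤ 4 * (s - t) ^ 2 := by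
      have : (a - b) ^ 2 = (s + t) ^ 2 * (s - t) ^ 2 := by rw [← hsa, ← htb]; ring
      rw [this]
      have : (s + t) ^ 2 ≤ 2 ^ 2 := by gcongr; linarith
      nlinarith [sq_nonneg (s - t)]
    have h5 : (s - t) ^ 2 = a + b - 2 * (s * t) := by rw [← hsa, ← htb]; ring
    nlinarith
  rcases le_total ρ (1 / 2) with h | h
  · rw [min_eq_left (by linarith)]
    exact half ρ a b h0 h ha hb ha1 hb1
  · rw [min_eq_right (by linarith)]
    have := half (1 - ρ) b a (by linarith) (by linarith) hb ha hb1 ha1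
    rw [sub_sub_cancel] at this
    nlinarith [this]

/-- Expected tempered posterior mass of `U`: if each parameter in `U` has a small expected
likelihood ratio and the likelihood ratio is rarely below `t` on a set `B` of positive prior mass,
then the mass of `U` is small. -/
lemma lintegral_div_lintegral_le {Θ Z : Type*} [MeasurableSpace Θ] [MeasurableSpace Z]
    (ν : Measure Θ) [IsFiniteMeasure ν] (P : Measure Z) [IsFiniteMeasure P]
    (R : Θ → Z → ℝ≥0∞) (hR : Measurable (Function.uncurry R))
    (U B : Set Θ) (hU : MeasurableSet U) (hB : MeasurableSet B) (u t η : ℝ≥0∞)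
    (hB0 : ν B ≠ 0)
    (hu : ∀ θ ∈ U, ∫⁻ z, R θ z ∂P ≤ u)
    (hη : ∀ θ ∈ B, P {z | R θ z < t} ≤ η) :
    ∫⁻ z, (∫⁻ θ in U, R θ z ∂ν) / (∫⁻ θ, R θ z ∂ν) ∂P ≤ 2 * η + 2 * u * ν U / (t * ν B) := by
  have hS : MeasurableSet {p : Θ × Z | R p.1 p.2 < t} := measurableSet_lt hR measurable_const
  set b := ν B with hb
  have hbt : b ≠ ∞ := measure_ne_top _ _
  -- `q z` is the mass of the part of `B` where the ratio is below `t`. By Fubini its mean is at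
  -- most `η ν(B)`, so Markov makes `q ≥ ν(B)/2` an event of probability at most `2η`. Otherwise
  -- half of `B` contributes at least `t` to the denominator.
  set q : Z → ℝ≥0∞ := fun z => ∫⁻ θ in B, ({p : Θ × Z | R p.1 p.2 < t}.indicator 1) (θ, z) ∂ν
    with hq
  have hqm : Measurable q := by
    apply Measurable.lintegral_prod_left'
      (f := fun p : Θ × Z => ({p : Θ × Z | R p.1 p.2 < t}.indicator (1 : Θ × Z → ℝ≥0∞)) p)
    exact measurable_one.indicator hS
  set E := {z | b / 2 ≤ q z}
  have hE : MeasurableSet E := measurableSet_le measurable_const hqm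
  have hb2 : b / 2 ≠ 0 := by simpa using hB0
  have hb2' : b / 2 ≠ ∞ := ENNReal.div_ne_top hbt (by simp)
  have hPE : P E ≤ 2 * η := by
    have h1 : P E ≤ (∫⁻ z, q z ∂P) / (b / 2) :=
      meas_ge_le_lintegral_div hqm.aemeasurable hb2 hb2'
    have h2 : ∫⁻ z, q z ∂P ≤ η * b := by
      rw [hq, lintegral_lintegral_swap]
      · calc _ ≤ ∫⁻ θ in B, η ∂ν := by
              apply setLIntegral_mono' hB
              intro θ hθ
              refine le_trans (le_of_eq ?_) (hη θ hθ)
              have : MeasurableSet {z | R θ z < t} :=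
                measurableSet_lt (hR.comp measurable_prodMk_left) measurable_const
              rw [← lintegral_indicator_one this]
              rfl
          _ = η * b := by rw [setLIntegral_const]
      · exact ((measurable_one.indicator hS).comp measurable_swap).aemeasurable
    refine h1.trans ?_
    rw [ENNReal.div_le_iff hb2 hb2']
    refine h2.trans (le_of_eq ?_)
    rw [mul_comm 2 η, mul_assoc, ENNReal.mul_div_cancel (by simp) (by simp)]
  set N : Z → ℝ≥0∞ := fun z => ∫⁻ θ in U, R θ z ∂ν
  have hNm : Measurable N := Measurable.lintegral_prod_left' hR
  have hN : ∫⁻ z, N z ∂P ≤ u * ν U := by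
    rw [lintegral_lintegral_swap]
    · calc _ ≤ ∫⁻ θ in U, u ∂ν := setLIntegral_mono' hU hu
        _ = _ := by rw [setLIntegral_const]
    · exact (hR.comp measurable_swap).aemeasurable
  have hD : ∀ z ∉ E, t * (b / 2) ≤ ∫⁻ θ, R θ z ∂ν := by
    intro z hz
    have hz' : q z < b / 2 := not_le.1 hz
    have hm1 : MeasurableSet {θ | R θ z < t} :=
      measurableSet_lt (hR.comp measurable_prodMk_right) measurable_const
    have hqz : q z = ν (B ∩ {θ | R θ z < t}) := by
      rw [Set.inter_comm, ← Measure.restrict_apply hm1, ← lintegral_indicator_one hm1]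
      rfl
    have hsplit : b ≤ ν (B ∩ {θ | R θ z < t}) + ν (B \ {θ | R θ z < t}) := by
      rw [measure_inter_add_sdiff _ hm1]
    have hge : b / 2 ≤ ν (B \ {θ | R θ z < t}) := by
      by_contra hcon
      rw [not_le] at hcon
      have := ENNReal.add_lt_add hz' hcon
      rw [hqz, ENNReal.add_halves] at this
      exact absurd hsplit (not_le.2 this)
    calc t * (b / 2) ≤ t * ν (B \ {θ | R θ z < t}) := by gcongr
      _ = ∫⁻ θ in B \ {θ | R θ z < t}, t ∂ν := by rw [setLIntegral_const]
      _ ≤ ∫⁻ θ in B \ {θ | R θ z < t}, R θ z ∂ν := by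
          apply setLIntegral_mono' (hB.diff hm1)
          intro θ hθ
          exact not_lt.1 hθ.2
      _ ≤ _ := setLIntegral_le_lintegral _ _
  have hpt : ∀ z, N z / (∫⁻ θ, R θ z ∂ν) ≤ E.indicator 1 z + N z / (t * (b / 2)) := by
    intro z
    by_cases hz : z ∈ E
    · rw [Set.indicator_of_mem hz]
      refine le_trans ?_ le_self_add
      exact ENNReal.div_le_of_le_mul (by rw [Pi.one_apply, one_mul]; exact setLIntegral_le_lintegral _ _)
    · refine le_trans ?_ le_add_self
      gcongr
      exact hD z hz
  calc _ ≤ ∫⁻ z, (E.indicator 1 z + N z / (t * (b / 2))) ∂P := lintegral_mono hpt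
    _ = P E + (∫⁻ z, N z ∂P) / (t * (b / 2)) := by
      rw [lintegral_add_left (measurable_one.indicator hE), lintegral_indicator_one hE]
      simp_rw [div_eq_mul_inv]
      rw [lintegral_mul_const _ hNm]
    _ ≤ 2 * η + (u * ν U) / (t * (b / 2)) := by gcongr
    _ = _ := by
      congr 1
      rw [mul_assoc 2, mul_comm 2 (u * ν U), ← mul_div_assoc t, ENNReal.div_eq_inv_mul,
        ENNReal.div_eq_inv_mul, ENNReal.div_eq_inv_mul, ENNReal.mul_inv (by simp) (by simp),
        inv_inv]
      ring

/-! ### The classification model -/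

section Model

variable {d : ℕ}

lemma labelProb_zero (f : Cube d → ℝ) (x : Cube d) :
    labelProb f (x, 0) = Real.sigmoid (-f x) := by
  simp [labelProb, Real.sigmoid_neg]

lemma labelProb_one (f : Cube d → ℝ) (x : Cube d) :
    labelProb f (x, 1) = Real.sigmoid (f x) := by
  simp [labelProb]

lemma labelProb_eq (f : Cube d → ℝ) (z : Cube d × Fin 2) :
    labelProb f z = Real.sigmoid (if z.2 = 0 then -f z.1 else f z.1) := by
  obtain ⟨x, y⟩ := z
  fin_cases y
  · exact labelProb_zero f x
  · exact labelProb_one f x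

lemma labelProb_pos (f : Cube d → ℝ) (z : Cube d × Fin 2) : 0 < labelProb f z := by
  rw [labelProb_eq]; exact Real.sigmoid_pos _

lemma labelProb_le_one (f : Cube d → ℝ) (z : Cube d × Fin 2) : labelProb f z ≤ 1 := by
  rw [labelProb_eq]; exact Real.sigmoid_le_one _

lemma sum_labelProb (f : Cube d → ℝ) (x : Cube d) : ∑ y : Fin 2, labelProb f (x, y) = 1 := by
  rw [Fin.sum_univ_two, labelProb_zero, labelProb_one, Real.sigmoid_neg]; ring

lemma measurable_labelProb_uncurry {Θ : Type*} [MeasurableSpace Θ] {F : Θ → Cube d → ℝ}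
    (hF : Measurable (Function.uncurry F)) :
    Measurable (fun p : Θ × (Cube d × Fin 2) => labelProb (F p.1) p.2) := by
  have h : Measurable (fun p : Θ × (Cube d × Fin 2) => F p.1 p.2.1) :=
    hF.comp (measurable_fst.prodMk (measurable_fst.comp measurable_snd))
  simp_rw [labelProb_eq]
  refine continuous_sigmoid.measurable.comp (Measurable.ite ?_ h.neg h)
  exact (measurable_snd.comp measurable_snd) (measurableSet_singleton (0 : Fin 2))

lemma measurable_labelProb {f : Cube d → ℝ} (hf : Measurable f) : Measurable (labelProb f) :=
  (measurable_labelProb_uncurry (Θ := Unit) (F := fun _ => f) (hf.comp measurable_snd)).comp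
    (measurable_const.prodMk measurable_id : Measurable fun z => ((), z))

lemma abs_log_labelProb_sub_le (f f₀ : Cube d → ℝ) (z : Cube d × Fin 2) :
    |Real.log (labelProb f z) - Real.log (labelProb f₀ z)| ≤ |f z.1 - f₀ z.1| := by
  rw [labelProb_eq, labelProb_eq]
  refine (abs_log_sigmoid_sub_le _ _).trans ?_
  split_ifs
  · rw [abs_sub_comm, neg_sub_neg, abs_sub_comm, abs_sub_comm]
  · rfl

variable {g : Cube d → ℝ} (hg : Measurable g) (hg0 : ∀ x, 0 ≤ g x)

lemma isProbabilityMeasure_designLaw (hg0 : ∀ x, 0 ≤ g x) (hg1 : ∫ x, g x = 1) :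
    IsProbabilityMeasure (designLaw g) := by
  constructor
  have hi : Integrable g := by
    by_contra h
    rw [integral_undef h] at hg1
    norm_num at hg1
  rw [designLaw, withDensity_apply _ MeasurableSet.univ, setLIntegral_univ,
    ← ofReal_integral_eq_lintegral_ofReal hi (Eventually.of_forall hg0), hg1, ENNReal.ofReal_one]

include hg hg0 in
lemma obsLaw_eq {f : Cube d → ℝ} (hf : Measurable f) :
    obsLaw g f = ((designLaw g).prod Measure.count).withDensity
      (fun z => ENNReal.ofReal (labelProb f z)) := by
  rw [designLaw, prod_withDensity_left (by fun_prop), ← withDensity_mul]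
  · rw [obsLaw]
    congr 1
    ext z
    rw [Pi.mul_apply, ← ENNReal.ofReal_mul (hg0 _), obsDensity, mul_comm]
  · fun_prop
  · exact (measurable_labelProb hf).ennreal_ofReal

include hg hg0 in
lemma lintegral_obsLaw {f : Cube d → ℝ} (hf : Measurable f) [SFinite (designLaw g)]
    {F : Cube d × Fin 2 → ℝ≥0∞} (hF : Measurable F) :
    ∫⁻ z, F z ∂(obsLaw g f) =
      ∫⁻ x, ∑ y : Fin 2, ENNReal.ofReal (labelProb f (x, y)) * F (x, y) ∂(designLaw g) := by
  have hl := (measurable_labelProb hf).ennreal_ofReal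
  rw [obsLaw_eq hg hg0 hf, lintegral_withDensity_eq_lintegral_mul _ hl hF,
    lintegral_prod _ (hl.mul hF).aemeasurable]
  simp only [lintegral_count, tsum_fintype, Pi.mul_apply]

include hg hg0 in
lemma lintegral_obsLaw_fst {f : Cube d → ℝ} (hf : Measurable f) [SFinite (designLaw g)]
    {F : Cube d → ℝ≥0∞} (hF : Measurable F) :
    ∫⁻ z, F z.1 ∂(obsLaw g f) = ∫⁻ x, F x ∂(designLaw g) := by
  rw [lintegral_obsLaw hg hg0 hf (by fun_prop)]
  refine lintegral_congr fun x => ?_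
  simp only
  rw [← Finset.sum_mul, ← ENNReal.ofReal_sum_of_nonneg fun y _ => (labelProb_pos f _).le,
    sum_labelProb, ENNReal.ofReal_one, one_mul]

include hg hg0 in
lemma isProbabilityMeasure_obsLaw {f : Cube d → ℝ} (hf : Measurable f)
    [IsProbabilityMeasure (designLaw g)] : IsProbabilityMeasure (obsLaw g f) := by
  constructor
  have := lintegral_obsLaw_fst hg hg0 hf (F := fun _ => 1) measurable_const
  simpa using this

include hg hg0 in
lemma integral_obsLaw {f : Cube d → ℝ} (hf : Measurable f) [SFinite (designLaw g)]
    {F : Cube d × Fin 2 → ℝ} (hF : Integrable F (obsLaw g f)) :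
    ∫ z, F z ∂(obsLaw g f) =
      ∫ x, ∑ y : Fin 2, labelProb f (x, y) * F (x, y) ∂(designLaw g) := by
  have hl := (measurable_labelProb hf).ennreal_ofReal
  rw [obsLaw_eq hg hg0 hf] at hF ⊢
  rw [integrable_withDensity_iff_integrable_smul' hl (by simp)] at hF
  rw [integral_withDensity_eq_integral_toReal_smul hl (by simp), integral_prod _ hF]
  refine integral_congr_ae (Eventually.of_forall fun x => ?_)
  simp only [ENNReal.toReal_ofReal (labelProb_pos f _).le, smul_eq_mul]
  rw [integral_fintype .of_finite]
  simp

include hg hg0 in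
lemma integrable_sum_labelProb_mul {f : Cube d → ℝ} (hf : Measurable f) [SFinite (designLaw g)]
    {F : Cube d × Fin 2 → ℝ} (hF : Integrable F (obsLaw g f)) :
    Integrable (fun x => ∑ y : Fin 2, labelProb f (x, y) * F (x, y)) (designLaw g) := by
  have hl := (measurable_labelProb hf).ennreal_ofReal
  rw [obsLaw_eq hg hg0 hf, integrable_withDensity_iff_integrable_smul' hl (by simp)] at hF
  refine hF.integral_prod_left.congr (Eventually.of_forall fun x => ?_)
  simp only [ENNReal.toReal_ofReal (labelProb_pos f _).le, smul_eq_mul]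
  rw [integral_fintype .of_finite]
  simp

/-- The tempered likelihood ratio of one observation. -/
noncomputable def temperedRatio (ρ : ℝ) (f f₀ : Cube d → ℝ) (z : Cube d × Fin 2) : ℝ≥0∞ :=
  ENNReal.ofReal ((labelProb f z / labelProb f₀ z) ^ ρ)

lemma measurable_temperedRatio_uncurry {Θ : Type*} [MeasurableSpace Θ] {F : Θ → Cube d → ℝ}
    (hF : Measurable (Function.uncurry F)) {f₀ : Cube d → ℝ} (hf₀ : Measurable f₀) (ρ : ℝ) :
    Measurable (fun p : Θ × (Cube d × Fin 2) => temperedRatio ρ (F p.1) f₀ p.2) :=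
  (((measurable_labelProb_uncurry hF).div
    ((measurable_labelProb hf₀).comp measurable_snd)).pow_const ρ).ennreal_ofReal

lemma measurable_temperedRatio_left {Θ : Type*} [MeasurableSpace Θ] {F : Θ → Cube d → ℝ}
    (hF : Measurable (Function.uncurry F)) {f₀ : Cube d → ℝ} (hf₀ : Measurable f₀) (ρ : ℝ)
    (z : Cube d × Fin 2) : Measurable fun θ => temperedRatio ρ (F θ) f₀ z := by
  have h := measurable_temperedRatio_uncurry hF hf₀ ρ
  have h2 : Measurable fun θ : Θ => (θ, z) := by fun_prop
  have h3 := h.comp h2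
  exact h3

lemma measurable_temperedRatio {f f₀ : Cube d → ℝ} (hf : Measurable f) (hf₀ : Measurable f₀)
    (ρ : ℝ) : Measurable (temperedRatio ρ f f₀) :=
  (((measurable_labelProb hf).div (measurable_labelProb hf₀)).pow_const ρ).ennreal_ofReal

lemma sum_abs_labelProb_le (f f₀ : Cube d → ℝ) (x : Cube d) :
    ∑ y : Fin 2, |labelProb f (x, y) - labelProb f₀ (x, y)| ≤ 2 := by
  have h : ∀ y, |labelProb f (x, y) - labelProb f₀ (x, y)| ≤ 1 := fun y => by
    rw [abs_le]
    constructor <;> linarith [labelProb_pos f (x, y), labelProb_le_one f (x, y),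
      labelProb_pos f₀ (x, y), labelProb_le_one f₀ (x, y)]
  rw [Fin.sum_univ_two]
  linarith [h 0, h 1]

/-- The summands are `p^ρ p₀^{1-ρ}`. The linear terms sum to 1, and the constant 8 is the 4 of the
refined mean inequality times the 2 from comparing squares with the square of the sum over two
labels. -/
lemma sum_labelProb_mul_temperedRatio_le {ρ : ℝ} (h0 : 0 < ρ) (h1 : ρ < 1) (f f₀ : Cube d → ℝ)
    (x : Cube d) :
    ∑ y : Fin 2, ENNReal.ofReal (labelProb f₀ (x, y)) * temperedRatio ρ f f₀ (x, y) ≤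
      ENNReal.ofReal (1 - min ρ (1 - ρ) / 8 *
        (∑ y : Fin 2, |labelProb f (x, y) - labelProb f₀ (x, y)|) ^ 2) := by
  have e : ∀ y, ENNReal.ofReal (labelProb f₀ (x, y)) * temperedRatio ρ f f₀ (x, y) =
      ENNReal.ofReal (labelProb f (x, y) ^ ρ * labelProb f₀ (x, y) ^ (1 - ρ)) := by
    intro y
    have hp := labelProb_pos f (x, y)
    have hp0 := labelProb_pos f₀ (x, y)
    rw [temperedRatio, ← ENNReal.ofReal_mul hp0.le, Real.div_rpow hp.le hp0.le,
      Real.rpow_sub hp0, Real.rpow_one]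
    congr 1
    ring
  simp_rw [e]
  rw [← ENNReal.ofReal_sum_of_nonneg fun y _ => mul_nonneg
    (Real.rpow_nonneg (labelProb_pos _ _).le _) (Real.rpow_nonneg (labelProb_pos _ _).le _)]
  apply ENNReal.ofReal_le_ofReal
  have hm : 0 ≤ min ρ (1 - ρ) := le_min h0.le (by linarith)
  have hy := fun y => rpow_mul_rpow_le_sub_sq h0 h1 (labelProb_pos f (x, y)).le
    (labelProb_pos f₀ (x, y)).le (labelProb_le_one f (x, y)) (labelProb_le_one f₀ (x, y))
  have s1 := sum_labelProb f x
  have s2 := sum_labelProb f₀ x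
  rw [Fin.sum_univ_two] at s1 s2 ⊢
  rw [Fin.sum_univ_two]
  have hy0 := hy 0
  have hy1 := hy 1
  have hsq : (|labelProb f (x, 0) - labelProb f₀ (x, 0)| +
      |labelProb f (x, 1) - labelProb f₀ (x, 1)|) ^ 2 ≤
      2 * ((labelProb f (x, 0) - labelProb f₀ (x, 0)) ^ 2 +
        (labelProb f (x, 1) - labelProb f₀ (x, 1)) ^ 2) := by
    rw [← sq_abs (labelProb f (x, 0) - _), ← sq_abs (labelProb f (x, 1) - _)]
    exact add_sq_le
  have hmsq := mul_le_mul_of_nonneg_left hsq hm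
  have e1 : ρ * labelProb f (x, 0) + ρ * labelProb f (x, 1) = ρ := by
    rw [← mul_add, s1, mul_one]
  have e2 : (1 - ρ) * labelProb f₀ (x, 0) + (1 - ρ) * labelProb f₀ (x, 1) = 1 - ρ := by
    rw [← mul_add, s2, mul_one]
  linarith

include hg hg0 in
/-- The Hellinger-type affinity of order `ρ` is controlled by the `L¹` distance. -/
lemma lintegral_temperedRatio_le {ρ : ℝ} (h0 : 0 < ρ) (h1 : ρ < 1) {f f₀ : Cube d → ℝ}
    (hf : Measurable f) (hf₀ : Measurable f₀) [IsProbabilityMeasure (designLaw g)] :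
    ∫⁻ z, temperedRatio ρ f f₀ z ∂(obsLaw g f₀) ≤
      ENNReal.ofReal (Real.exp (-(min ρ (1 - ρ) / 8 * distG1 g f f₀ ^ 2))) := by
  set S : Cube d → ℝ := fun x => ∑ y : Fin 2, |labelProb f (x, y) - labelProb f₀ (x, y)| with hS
  have hm : 0 ≤ min ρ (1 - ρ) := le_min h0.le (by linarith)
  have hm2 : min ρ (1 - ρ) ≤ 1 := (min_le_left _ _).trans h1.le
  have hS0 : ∀ x, 0 ≤ S x := fun x => Finset.sum_nonneg fun y _ => abs_nonneg _
  have hS2 : ∀ x, S x ≤ 2 := sum_abs_labelProb_le f f₀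
  have hSm : Measurable S := by
    refine Finset.measurable_sum _ fun y _ => ?_
    exact (((measurable_labelProb hf).comp measurable_prodMk_right).sub
      ((measurable_labelProb hf₀).comp measurable_prodMk_right)).abs
  have hL : MemLp S 2 (designLaw g) :=
    MemLp.of_bound hSm.aestronglyMeasurable 2 (Eventually.of_forall fun x => by
      rw [Real.norm_of_nonneg (hS0 x)]; exact hS2 x)
  have hsq : Integrable (fun x => S x ^ 2) (designLaw g) := hL.integrable_sq
  rw [lintegral_obsLaw hg hg0 hf₀ (measurable_temperedRatio hf hf₀ ρ)]
  refine (lintegral_mono (sum_labelProb_mul_temperedRatio_le h0 h1 f f₀)).trans ?_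
  change ∫⁻ x, ENNReal.ofReal (1 - min ρ (1 - ρ) / 8 * S x ^ 2) ∂(designLaw g) ≤ _
  have hi : Integrable (fun x => 1 - min ρ (1 - ρ) / 8 * S x ^ 2) (designLaw g) :=
    (integrable_const _).sub (hsq.const_mul _)
  rw [← ofReal_integral_eq_lintegral_ofReal hi]
  · apply ENNReal.ofReal_le_ofReal
    rw [integral_sub (integrable_const _) (hsq.const_mul _), integral_const_mul, integral_const,
      probReal_univ, one_smul]
    have hv := variance_nonneg S (designLaw g)
    rw [variance_eq_sub hL] at hv
    have hd : distG1 g f f₀ = ∫ x, S x ∂(designLaw g) := rfl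
    have hle : distG1 g f f₀ ^ 2 ≤ ∫ x, S x ^ 2 ∂(designLaw g) := by
      rw [hd]; exact sub_nonneg.1 hv
    have := Real.add_one_le_exp (-(min ρ (1 - ρ) / 8 * distG1 g f f₀ ^ 2))
    nlinarith
  · refine Eventually.of_forall fun x => ?_
    have : S x ^ 2 ≤ 2 ^ 2 := by exact pow_le_pow_left₀ (hS0 x) (hS2 x) 2
    change 0 ≤ 1 - min ρ (1 - ρ) / 8 * S x ^ 2
    nlinarith [sq_nonneg (S x)]

lemma lintegral_pi_prod {ι : Type*} [Fintype ι] {Z : Type*} [MeasurableSpace Z] (P : Measure Z)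
    [IsProbabilityMeasure P] {F : Z → ℝ≥0∞} (hF : Measurable F) :
    ∫⁻ z : ι → Z, ∏ i, F (z i) ∂(Measure.pi fun _ => P) = (∫⁻ z, F z ∂P) ^ Fintype.card ι := by
  rw [lintegral_prod_eq_prod_lintegral_of_indepFun Finset.univ
    (fun i (z : ι → Z) => F (z i)) (iIndepFun_pi (X := fun _ => F) fun _ => hF.aemeasurable)
    (fun i => hF.comp (measurable_pi_apply i))]
  rw [← Finset.card_univ, ← Finset.prod_const]
  refine Finset.prod_congr rfl fun i _ => ?_
  exact (measurePreserving_eval (fun _ : ι => P) i).lintegral_comp hF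

lemma prod_temperedRatio {n : ℕ} (ρ : ℝ) (f f₀ : Cube d → ℝ) (z : Fin n → Cube d × Fin 2) :
    ∏ i, temperedRatio ρ f f₀ (z i) = ENNReal.ofReal (Real.exp (ρ * ∑ i,
      (Real.log (labelProb f (z i)) - Real.log (labelProb f₀ (z i))))) := by
  simp_rw [temperedRatio]
  rw [← ENNReal.ofReal_prod_of_nonneg fun i _ => Real.rpow_nonneg
    (div_pos (labelProb_pos _ _) (labelProb_pos _ _)).le _, Finset.mul_sum, Real.exp_sum]
  congr 1
  refine Finset.prod_congr rfl fun i _ => ?_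
  rw [Real.rpow_def_of_pos (div_pos (labelProb_pos _ _) (labelProb_pos _ _)),
    Real.log_div (labelProb_pos _ _).ne' (labelProb_pos _ _).ne', mul_comm]

include hg hg0 in
/-- If `f` is close to `f₀` in `L²(G)`, then the tempered likelihood ratio is unlikely to be
small. -/
lemma measure_prod_temperedRatio_lt_le {ρ V : ℝ} (h0 : 0 < ρ) (hV : 0 < V) {f f₀ : Cube d → ℝ}
    (hf : Measurable f) (hf₀ : Measurable f₀) [IsProbabilityMeasure (designLaw g)]
    (hfV : ∫⁻ x, ENNReal.ofReal ((f x - f₀ x) ^ 2) ∂(designLaw g) ≤ ENNReal.ofReal V)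
    {n : ℕ} (hn : 0 < n) :
    (Measure.pi fun _ : Fin n => obsLaw g f₀)
      {z | ∏ i, temperedRatio ρ f f₀ (z i) < ENNReal.ofReal (Real.exp (-(2 * ρ * (n * V))))} ≤
      ENNReal.ofReal (1 / (n * V)) := by
  have := isProbabilityMeasure_obsLaw hg hg0 hf₀
  set W : Cube d × Fin 2 → ℝ := fun z =>
    Real.log (labelProb f z) - Real.log (labelProb f₀ z) with hW
  have hWm : Measurable W := (measurable_labelProb hf).log.sub (measurable_labelProb hf₀).log
  have hn' : (0 : ℝ) < n := by exact_mod_cast hn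
  have hsqm : Measurable fun x => (f x - f₀ x) ^ 2 := (hf.sub hf₀).pow_const 2
  have hW2 : ∫⁻ z, ENNReal.ofReal (W z ^ 2) ∂(obsLaw g f₀) ≤ ENNReal.ofReal V := by
    refine le_trans ?_ hfV
    rw [← lintegral_obsLaw_fst hg hg0 hf₀ hsqm.ennreal_ofReal]
    refine lintegral_mono fun z => ENNReal.ofReal_le_ofReal ?_
    rw [← sq_abs (W z), ← sq_abs (f z.1 - _)]
    exact pow_le_pow_left₀ (abs_nonneg _) (abs_log_labelProb_sub_le f f₀ z) 2
  have hWsq : Integrable (fun z => W z ^ 2) (obsLaw g f₀) := by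
    refine (lintegral_ofReal_ne_top_iff_integrable (hWm.pow_const 2).aestronglyMeasurable
      (Eventually.of_forall fun z => sq_nonneg _)).1 ?_
    exact ne_top_of_le_ne_top ENNReal.ofReal_ne_top hW2
  have hWL : MemLp W 2 (obsLaw g f₀) :=
    (memLp_two_iff_integrable_sq hWm.aestronglyMeasurable).2 hWsq
  have hWi : Integrable W (obsLaw g f₀) := hWL.integrable (by norm_num)
  have hEsq : ∫ z, W z ^ 2 ∂(obsLaw g f₀) ≤ V := by
    rw [integral_eq_lintegral_of_nonneg_ae (Eventually.of_forall fun z => sq_nonneg _)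
      (hWm.pow_const 2).aestronglyMeasurable]
    exact ENNReal.toReal_le_of_le_ofReal hV.le hW2
  have hfi : Integrable (fun x => (f x - f₀ x) ^ 2) (designLaw g) := by
    refine (lintegral_ofReal_ne_top_iff_integrable hsqm.aestronglyMeasurable
      (Eventually.of_forall fun z => sq_nonneg _)).1 ?_
    exact ne_top_of_le_ne_top ENNReal.ofReal_ne_top hfV
  have hE : -V ≤ ∫ z, W z ∂(obsLaw g f₀) := by
    rw [integral_obsLaw hg hg0 hf₀ hWi, neg_le, ← integral_neg]
    calc _ ≤ ∫ x, (f x - f₀ x) ^ 2 ∂(designLaw g) := by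
          refine integral_mono (integrable_sum_labelProb_mul hg hg0 hf₀ hWi).neg hfi fun x => ?_
          have := bernoulli_kl_le (f₀ x) (f x)
          simp only [Fin.sum_univ_two, hW, labelProb_zero, labelProb_one]
          nlinarith
      _ ≤ V := by
          rw [integral_eq_lintegral_of_nonneg_ae (Eventually.of_forall fun z => sq_nonneg _)
            hsqm.aestronglyMeasurable]
          exact ENNReal.toReal_le_of_le_ofReal hV.le hfV
  set Y : (Fin n → Cube d × Fin 2) → ℝ := ∑ i, fun z => W (z i) with hY
  have hYL : MemLp Y 2 (Measure.pi fun _ : Fin n => obsLaw g f₀) := by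
    refine memLp_finsetSum' _ fun i _ => ?_
    exact hWL.comp_measurePreserving (measurePreserving_eval _ i)
  have hvar : Var[Y; Measure.pi fun _ : Fin n => obsLaw g f₀] ≤ n * V := by
    rw [hY, variance_sum_pi (X := fun _ => W) fun _ => hWL]
    have h1 : Var[W; obsLaw g f₀] ≤ V := by
      rw [variance_eq_sub hWL]
      have : ∫ z, (W ^ 2) z ∂(obsLaw g f₀) ≤ V := hEsq
      nlinarith [sq_nonneg (∫ z, W z ∂(obsLaw g f₀))]
    simp only [Finset.sum_const, Finset.card_univ, Fintype.card_fin, nsmul_eq_mul]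
    gcongr
  have hYE : -(n * V) ≤ ∫ z, Y z ∂(Measure.pi fun _ : Fin n => obsLaw g f₀) := by
    simp only [hY, Finset.sum_apply]
    rw [integral_finsetSum _ fun i _ => integrable_comp_eval (μ := fun _ => obsLaw g f₀) hWi]
    simp_rw [integral_comp_eval (μ := fun _ : Fin n => obsLaw g f₀) hWm.aestronglyMeasurable]
    simp only [Finset.sum_const, Finset.card_univ, Fintype.card_fin, nsmul_eq_mul]
    nlinarith
  have hc : 0 < n * V := by positivity
  -- The sum `Y` of log-ratios has mean at least `-nV` and variance at most `nV`. Falling below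
  -- `-2nV` is thus a deviation of at least `nV`, and Chebyshev gives `nV/(nV)²`.
  calc _ ≤ (Measure.pi fun _ : Fin n => obsLaw g f₀)
        {z | n * V ≤ |Y z - ∫ z, Y z ∂(Measure.pi fun _ : Fin n => obsLaw g f₀)|} := by
        refine measure_mono fun z hz => ?_
        rw [Set.mem_ofPred_eq, prod_temperedRatio, ENNReal.ofReal_lt_ofReal_iff (Real.exp_pos _),
          Real.exp_lt_exp] at hz
        have hz' : Y z < -(2 * (n * V)) := by
          have : ρ * Y z < ρ * (-(2 * (n * V))) := by
            simp only [hY, Finset.sum_apply]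
            calc _ = _ := rfl
              _ < _ := hz
              _ = _ := by ring
          exact lt_of_mul_lt_mul_left this h0.le
        rw [Set.mem_ofPred_eq, le_abs]
        right
        linarith
    _ ≤ _ := meas_ge_le_variance_div_sq hYL hc
    _ ≤ _ := by
        apply ENNReal.ofReal_le_ofReal
        rw [div_le_div_iff₀ (by positivity) hc]
        nlinarith

include hg hg0 in
lemma ae_pi_obsLaw_pos {f₀ : Cube d → ℝ} (hf₀ : Measurable f₀) [IsProbabilityMeasure (designLaw g)]
    (n : ℕ) : ∀ᵐ z ∂(Measure.pi fun _ : Fin n => obsLaw g f₀), ∀ i, 0 < g (z i).1 := by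
  have := isProbabilityMeasure_obsLaw hg hg0 hf₀
  have h1 : ∀ᵐ z ∂(obsLaw g f₀), 0 < g z.1 := by
    have hm : Measurable (fun z => ENNReal.ofReal (obsDensity g f₀ z)) :=
      ((measurable_labelProb hf₀).mul (hg.comp measurable_fst)).ennreal_ofReal
    rw [obsLaw, ae_withDensity_iff hm]
    refine Eventually.of_forall fun z hz => (hg0 _).lt_of_ne fun h => hz ?_
    rw [obsDensity, ← h, mul_zero, ENNReal.ofReal_zero]
  rw [ae_all_iff]
  intro i
  exact (measurePreserving_eval (fun _ : Fin n => obsLaw g f₀) i).quasiMeasurePreserving.ae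
    (p := fun z => 0 < g z.1) h1

/-- Numerator and denominator are both divided by the likelihood of `f₀` to the power `ρ`, which
removes `g`. This requires `g > 0` at the observations, an almost sure event under `P₀`. -/
lemma temperedPosterior_obsDensity {Θ : Type*} [MeasurableSpace Θ] (ν : Measure Θ)
    {F : Θ → Cube d → ℝ} (hF : Measurable (Function.uncurry F)) {f₀ : Cube d → ℝ}
    (hf₀ : Measurable f₀) (ρ : ℝ) {n : ℕ} (z : Fin n → Cube d × Fin 2)
    (hz : ∀ i, 0 < g (z i).1) (B : Set Θ) :
    temperedPosterior ν (fun θ (w : Fin n → Cube d × Fin 2) => ∏ i, obsDensity g (F θ) (w i)) ρ z B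
      = (∫⁻ θ in B, ∏ i, temperedRatio ρ (F θ) f₀ (z i) ∂ν) /
          ∫⁻ θ, ∏ i, temperedRatio ρ (F θ) f₀ (z i) ∂ν := by
  set c : ℝ≥0∞ := ENNReal.ofReal (∏ i, obsDensity g f₀ (z i) ^ ρ) with hc
  have hpos : ∀ f i, 0 < obsDensity g f (z i) := fun f i => mul_pos (labelProb_pos _ _) (hz i)
  have hc0 : c ≠ 0 := by
    rw [hc, Ne, ENNReal.ofReal_eq_zero, not_le]
    exact Finset.prod_pos fun i _ => Real.rpow_pos_of_pos (hpos _ i) _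
  have e : ∀ θ, ENNReal.ofReal ((∏ i, obsDensity g (F θ) (z i)) ^ ρ) =
      c * ∏ i, temperedRatio ρ (F θ) f₀ (z i) := by
    intro θ
    simp_rw [temperedRatio]
    rw [hc, ← ENNReal.ofReal_prod_of_nonneg fun i _ => Real.rpow_nonneg
      (div_pos (labelProb_pos _ _) (labelProb_pos _ _)).le _, ← ENNReal.ofReal_mul
      (Finset.prod_nonneg fun i _ => Real.rpow_nonneg (hpos _ i).le _), ← Finset.prod_mul_distrib,
      ← Real.finsetProd_rpow _ _ fun i _ => (hpos _ i).le]
    congr 1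
    refine Finset.prod_congr rfl fun i _ => ?_
    rw [← Real.mul_rpow (hpos _ i).le (div_pos (labelProb_pos _ _) (labelProb_pos _ _)).le]
    congr 1
    have h := (labelProb_pos f₀ (z i)).ne'
    calc labelProb (F θ) (z i) * g (z i).1
        = labelProb f₀ (z i) * (labelProb (F θ) (z i) / labelProb f₀ (z i)) * g (z i).1 := by
          rw [mul_div_cancel₀ _ h]
      _ = obsDensity g f₀ (z i) * (labelProb (F θ) (z i) / labelProb f₀ (z i)) := by
          rw [obsDensity]; ring
  have hm1 : ∀ i, Measurable fun θ => temperedRatio ρ (F θ) f₀ (z i) := fun i =>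
    measurable_temperedRatio_left hF hf₀ ρ (z i)
  have hm : Measurable fun θ => ∏ i, temperedRatio ρ (F θ) f₀ (z i) :=
    Finset.measurable_prod _ fun i _ => hm1 i
  simp_rw [temperedPosterior, e]
  rw [lintegral_const_mul _ hm, lintegral_const_mul _ hm,
    ENNReal.mul_div_mul_left _ _ hc0 ENNReal.ofReal_ne_top]

end Model

/-! ### Series expansions -/

section Series

variable {d : ℕ} (φ : HilbertBasis ℕ ℝ (L2Cube d))

lemma measurable_seriesFun_uncurry : Measurable (Function.uncurry (seriesFun φ)) := by
  have h : ∀ k, Measurable fun p : (ℕ → ℝ) × Cube d => p.1 k * φ k p.2 := fun k =>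
    ((measurable_pi_apply k).comp measurable_fst).mul
      ((Lp.stronglyMeasurable (φ k)).measurable.comp measurable_snd)
  exact Measurable.tsum h

lemma measurable_seriesFun (θ : ℕ → ℝ) : Measurable (seriesFun φ θ) := by
  have h2 : Measurable fun x : Cube d => (θ, x) := by fun_prop
  have h3 := (measurable_seriesFun_uncurry φ).comp h2
  exact h3

lemma lintegral_enorm_basis_le_one (k : ℕ) : ∫⁻ x, ‖φ k x‖ₑ ≤ 1 := by
  rw [← eLpNorm_one_eq_lintegral_enorm]
  refine (eLpNorm_le_eLpNorm_of_exponent_le (q := 2) (by norm_num)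
    (Lp.aestronglyMeasurable _)).trans ?_
  rw [← Lp.enorm_def, ← ofReal_norm, φ.orthonormal.1 k, ENNReal.ofReal_one]

/-- On a probability space `‖φ_k‖₁ ≤ ‖φ_k‖₂ = 1`, so `∑ |θ_k φ_k|` is integrable. Without
summability at a point, `tsum` would return 0 there; hence the `ℓ¹` condition carried along below.
-/
lemma ae_summable_seriesFun {θ : ℕ → ℝ} (hθ : Summable fun k => |θ k|) :
    ∀ᵐ x : Cube d, Summable fun k => θ k * φ k x := by
  have hm : ∀ k, Measurable fun x => ‖θ k * φ k x‖ₑ := fun k =>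
    ((Lp.stronglyMeasurable (φ k)).measurable.const_mul (θ k)).enorm
  have h : ∫⁻ x : Cube d, ∑' k, ‖θ k * φ k x‖ₑ ≠ ∞ := by
    rw [lintegral_tsum fun k => (hm k).aemeasurable]
    have : ∀ k, ∫⁻ x : Cube d, ‖θ k * φ k x‖ₑ ≤ ENNReal.ofReal |θ k| := fun k => by
      simp_rw [enorm_mul]
      rw [lintegral_const_mul _ (Lp.stronglyMeasurable (φ k)).measurable.enorm,
        ← Real.norm_eq_abs, ofReal_norm]
      exact mul_le_of_le_one_right' (lintegral_enorm_basis_le_one φ k)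
    exact ne_top_of_le_ne_top hθ.tsum_ofReal_ne_top (ENNReal.tsum_le_tsum this)
  filter_upwards [ae_lt_top (Measurable.tsum hm) h] with x hx
  refine Summable.of_norm ?_
  simpa using ENNReal.summable_toReal hx.ne

lemma lintegral_sq_eq_norm_sq (u : L2Cube d) :
    ∫⁻ x, ENNReal.ofReal (u x ^ 2) = ENNReal.ofReal (‖u‖ ^ 2) := by
  have hi : Integrable fun x => u x ^ 2 := (Lp.memLp u).integrable_sq
  rw [← ofReal_integral_eq_lintegral_ofReal hi (Eventually.of_forall fun x => sq_nonneg _),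
    ← real_inner_self_eq_norm_sq, L2.inner_def]
  simp [sq]

lemma coeFn_sum_smul (θ : ℕ → ℝ) (N : ℕ) :
    ⇑(∑ k ∈ Finset.range N, θ k • φ k : L2Cube d) =ᵐ[volume]
      fun x => ∑ k ∈ Finset.range N, θ k * φ k x := by
  induction N with
  | zero =>
    simp only [Finset.range_zero, Finset.sum_empty]
    exact Lp.coeFn_zero _ _ _
  | succ N ih =>
    rw [Finset.sum_range_succ]
    filter_upwards [Lp.coeFn_add (∑ k ∈ Finset.range N, θ k • φ k : L2Cube d) (θ N • φ N), ih,
      Lp.coeFn_smul (θ N) (φ N)] with x h1 h2 h3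
    rw [h1, Pi.add_apply, h2, h3, Finset.sum_range_succ, Pi.smul_apply, smul_eq_mul]

/-- Parseval's identity, as an upper bound for the pointwise version of the series. -/
lemma lintegral_sq_seriesFun_sub_le {θ : ℕ → ℝ} (hθ : Summable fun k => |θ k|) (f₀ : L2Cube d)
    {v : ℝ} (hv : ∀ N, ∑ k ∈ Finset.range N, (θ k - inner ℝ f₀ (φ k)) ^ 2 ≤ v) :
    ∫⁻ x, ENNReal.ofReal ((seriesFun φ θ x - f₀ x) ^ 2) ≤ ENNReal.ofReal v := by
  have hs : Summable fun k => θ k • φ k := by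
    refine Summable.of_norm ?_
    simpa [norm_smul, φ.orthonormal.1] using hθ
  set F : L2Cube d := ∑' k, θ k • φ k with hF
  set S : ℕ → L2Cube d := fun N => ∑ k ∈ Finset.range N, θ k • φ k with hS
  have hSF : Tendsto S atTop (𝓝 F) := hs.hasSum.tendsto_sum_nat
  have hcoef : ∀ k, inner ℝ (F - f₀) (φ k) = θ k - inner ℝ f₀ (φ k) := by
    intro k
    have h := (hs.hasSum.mapL (innerSL ℝ (φ k))).tsum_eq
    simp only [innerSL_apply_apply, inner_smul_right, orthonormal_iff_ite.1 φ.orthonormal] at h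
    rw [inner_sub_left, real_inner_comm, hF, ← h]
    simp
  have hnorm : ‖F - f₀‖ ^ 2 ≤ v := by
    have h := (φ.hasSum_inner_mul_inner (F - f₀) (F - f₀)).tendsto_sum_nat
    rw [real_inner_self_eq_norm_sq] at h
    refine le_of_tendsto' h fun N => ?_
    refine le_trans (le_of_eq (Finset.sum_congr rfl fun k _ => ?_)) (hv N)
    rw [real_inner_comm (F - f₀) (φ k), ← sq, hcoef]
  have hlim : Tendsto (fun N => ∫⁻ x, ENNReal.ofReal ((S N x - f₀ x) ^ 2)) atTop
      (𝓝 (ENNReal.ofReal (‖F - f₀‖ ^ 2))) := by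
    have e : ∀ N, ∫⁻ x, ENNReal.ofReal ((S N x - f₀ x) ^ 2) =
        ENNReal.ofReal (‖S N - f₀‖ ^ 2) := by
      intro N
      rw [← lintegral_sq_eq_norm_sq]
      refine lintegral_congr_ae ?_
      filter_upwards [Lp.coeFn_sub (S N) f₀] with x hx
      rw [hx, Pi.sub_apply]
    simp_rw [e]
    exact (ENNReal.continuous_ofReal.tendsto _).comp (((hSF.sub_const f₀).norm).pow 2)
  have hpt : ∀ᵐ x : Cube d, Tendsto (fun N => ENNReal.ofReal ((S N x - f₀ x) ^ 2)) atTop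
      (𝓝 (ENNReal.ofReal ((seriesFun φ θ x - f₀ x) ^ 2))) := by
    have hco : ∀ᵐ x : Cube d, ∀ N, S N x = ∑ k ∈ Finset.range N, θ k * φ k x :=
      ae_all_iff.2 fun N => coeFn_sum_smul φ θ N
    filter_upwards [ae_summable_seriesFun φ hθ, hco] with x hx hx2
    simp_rw [hx2]
    exact (ENNReal.continuous_ofReal.tendsto _).comp
      ((hx.hasSum.tendsto_sum_nat.sub_const _).pow 2)
  -- Fatou transfers the bound from the partial sums, which converge both in `L²` and almost
  -- everywhere, to the pointwise series.
  calc _ = ∫⁻ x, liminf (fun N => ENNReal.ofReal ((S N x - f₀ x) ^ 2)) atTop := by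
        refine lintegral_congr_ae ?_
        filter_upwards [hpt] with x hx
        rw [hx.liminf_eq]
    _ ≤ liminf (fun N => ∫⁻ x, ENNReal.ofReal ((S N x - f₀ x) ^ 2)) atTop := by
        refine lintegral_liminf_le fun N => ?_
        exact (((Lp.stronglyMeasurable (S N)).measurable.sub
          (Lp.stronglyMeasurable f₀).measurable).pow_const 2).ennreal_ofReal
    _ = ENNReal.ofReal (‖F - f₀‖ ^ 2) := hlim.liminf_eq
    _ ≤ _ := ENNReal.ofReal_le_ofReal hnorm

end Series

/-! ### Heavy-tailed laws -/

namespace IsHeavyTailed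

variable {H : Measure ℝ} {h : ℝ → ℝ} {c₁ κ c₂ : ℝ}

lemma apply_le_of_abs_le (hH : IsHeavyTailed H h c₁ κ c₂) {x y : ℝ} (hxy : |x| ≤ y) :
    h y ≤ h x := by
  have e : h |x| = h x := by
    rcases abs_choice x with hx | hx <;> rw [hx]
    exact hH.symmetric x
  rw [← e]
  exact hH.decreasing (abs_nonneg x) ((abs_nonneg x).trans hxy) hxy

lemma measure_Ioi (hH : IsHeavyTailed H h c₁ κ c₂) (t : ℝ) :
    H (Set.Ioi t) = ENNReal.ofReal (∫ u in Set.Ioi t, h u) := by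
  rw [hH.hasDensity, withDensity_apply _ measurableSet_Ioi,
    ofReal_integral_eq_lintegral_ofReal hH.integrable.restrict
      (Eventually.of_forall fun x => (hH.positive x).le)]

lemma measure_Iio_neg (hH : IsHeavyTailed H h c₁ κ c₂) (t : ℝ) :
    H (Set.Iio (-t)) = H (Set.Ioi t) := by
  rw [hH.hasDensity, withDensity_apply _ measurableSet_Iio, withDensity_apply _ measurableSet_Ioi]
  have hp := (Measure.measurePreserving_neg (volume : Measure ℝ)).setLIntegral_comp_preimage_emb
    (MeasurableEquiv.neg ℝ).measurableEmbedding (fun x => ENNReal.ofReal (h x)) (Set.Ioi t)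
  rw [← hp]
  simp only [hH.symmetric]
  congr 2
  ext x
  simp

lemma measure_lt_abs_le (hH : IsHeavyTailed H h c₁ κ c₂) {t : ℝ} (ht : 1 ≤ t) :
    H {x | t < |x|} ≤ ENNReal.ofReal (2 * c₂ / t ^ 2) := by
  have e : {x : ℝ | t < |x|} ⊆ Set.Ioi t ∪ Set.Iio (-t) := by
    intro x hx
    rw [Set.mem_ofPred_eq, lt_abs] at hx
    rcases hx with h | h
    · exact Or.inl h
    · exact Or.inr (lt_neg.1 h)
  have h1 := hH.tail_le t ht
  have h2 : 0 ≤ c₂ / t ^ 2 :=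
    (integral_nonneg fun u => (hH.positive u).le).trans h1
  calc H {x | t < |x|} ≤ H (Set.Ioi t) + H (Set.Iio (-t)) :=
        (measure_mono e).trans (measure_union_le _ _)
    _ = 2 * ENNReal.ofReal (∫ u in Set.Ioi t, h u) := by
        rw [hH.measure_Iio_neg, hH.measure_Ioi, two_mul]
    _ ≤ 2 * ENNReal.ofReal (c₂ / t ^ 2) := by gcongr
    _ = _ := by
        rw [mul_div_assoc, ENNReal.ofReal_mul (by norm_num)]
        simp

/-- Layer-cake formula: the tail is at most 1 on `(0,1]` and of order `t⁻²` beyond. -/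
lemma lintegral_abs_ne_top (hH : IsHeavyTailed H h c₁ κ c₂) [IsProbabilityMeasure H] :
    ∫⁻ x, ENNReal.ofReal |x| ∂H ≠ ∞ := by
  rw [lintegral_eq_lintegral_meas_lt H (Eventually.of_forall fun x => abs_nonneg x)
    measurable_abs.aemeasurable]
  have hsub : Set.Ioi (0 : ℝ) ⊆ Set.Ioc 0 1 ∪ Set.Ioi 1 := fun x hx => by
    rcases le_or_gt x 1 with h | h
    · exact Or.inl ⟨hx, h⟩
    · exact Or.inr h
  refine ne_top_of_le_ne_top ?_ ((lintegral_mono_set hsub).trans (lintegral_union_le _ _ _))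
  refine ENNReal.add_ne_top.2 ⟨?_, ?_⟩
  · refine ne_top_of_le_ne_top (b := ∫⁻ _ in Set.Ioc (0 : ℝ) 1, 1) ?_
      (lintegral_mono fun t => prob_le_one)
    rw [setLIntegral_const]
    simp
  · have hi : IntegrableOn (fun t : ℝ => 2 * c₂ * t ^ (-2 : ℝ)) (Set.Ioi 1) :=
      (integrableOn_Ioi_rpow_of_lt (by norm_num) one_pos).const_mul _
    refine ne_top_of_le_ne_top hi.lintegral_lt_top.ne ?_
    refine setLIntegral_mono' measurableSet_Ioi fun t ht => ?_
    refine (hH.measure_lt_abs_le (le_of_lt ht)).trans (le_of_eq ?_)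
    have ht0 : (0 : ℝ) < t := one_pos.trans ht
    rw [Real.rpow_neg ht0.le, div_eq_mul_inv]
    norm_cast

/-- The inequality `1 - y ≥ e^{-2y}` for `y ≤ 1/2`, with `y = 2c₂/t²`, puts the mass in exponential
form, so that infinitely many factors can be multiplied by summing exponents. -/
lemma measure_abs_le_ge (hH : IsHeavyTailed H h c₁ κ c₂) [IsProbabilityMeasure H] {t : ℝ}
    (ht : 1 ≤ t) (ht2 : 4 * c₂ ≤ t ^ 2) (hc₂ : 0 < c₂) :
    ENNReal.ofReal (Real.exp (-(4 * c₂ / t ^ 2))) ≤ H {x | |x| ≤ t} := by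
  have ht0 : 0 < t ^ 2 := by positivity
  have hc : H {x | |x| ≤ t} = 1 - H {x | t < |x|} := by
    rw [← prob_compl_eq_one_sub (measurableSet_lt measurable_const measurable_abs)]
    congr 1
    ext x
    simp
  set y := 2 * c₂ / t ^ 2 with hy
  have hy0 : 0 ≤ y := by positivity
  have hy1 : y ≤ 1 / 2 := by
    rw [hy, div_le_div_iff₀ ht0 two_pos]
    linarith
  have hexp : Real.exp (-(4 * c₂ / t ^ 2)) ≤ 1 - y := by
    have e : 4 * c₂ / t ^ 2 = 2 * y := by rw [hy]; ring
    rw [e, Real.exp_neg, inv_le_comm₀ (Real.exp_pos _) (by linarith)]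
    refine le_trans ?_ (Real.add_one_le_exp (2 * y))
    rw [inv_le_iff_one_le_mul₀ (by linarith)]
    nlinarith
  rw [hc]
  calc _ ≤ ENNReal.ofReal (1 - y) := ENNReal.ofReal_le_ofReal hexp
    _ = 1 - ENNReal.ofReal y := by rw [ENNReal.ofReal_sub _ hy0, ENNReal.ofReal_one]
    _ ≤ _ := tsub_le_tsub_left (hH.measure_lt_abs_le ht) _

lemma measure_abs_sub_le_ge (hH : IsHeavyTailed H h c₁ κ c₂) (x₀ : ℝ) {w : ℝ}
    (hw0 : 0 ≤ w) (hw1 : w ≤ 1) :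
    ENNReal.ofReal (w * h (|x₀| + 1)) ≤ H {x | |x - x₀| ≤ w} := by
  have e : {x : ℝ | |x - x₀| ≤ w} = Set.Icc (x₀ - w) (x₀ + w) := by
    ext x
    simp only [Set.mem_ofPred_eq, abs_le, Set.mem_Icc]
    constructor <;> rintro ⟨h1, h2⟩ <;> constructor <;> linarith
  rw [e, hH.hasDensity, withDensity_apply _ measurableSet_Icc]
  calc _ ≤ ENNReal.ofReal (h (|x₀| + 1)) * volume (Set.Icc (x₀ - w) (x₀ + w)) := by
        rw [Real.volume_Icc, mul_comm, ENNReal.ofReal_mul (hH.positive _).le]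
        gcongr
        linarith
    _ = ∫⁻ x in Set.Icc (x₀ - w) (x₀ + w), ENNReal.ofReal (h (|x₀| + 1)) := by
        rw [setLIntegral_const]
    _ ≤ _ := by
        refine setLIntegral_mono' measurableSet_Icc fun x hx => ENNReal.ofReal_le_ofReal ?_
        apply hH.apply_le_of_abs_le
        have : |x - x₀| ≤ w := by
          rw [abs_le]; constructor <;> linarith [hx.1, hx.2]
        calc |x| = |x₀ + (x - x₀)| := by congr 1; ring
          _ ≤ |x₀| + |x - x₀| := abs_add_le _ _
          _ ≤ |x₀| + 1 := by linarith

end IsHeavyTailed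

/-! ### Prior mass -/

/-- A discrete integral comparison: each term is dominated by a telescoping difference, through
`log((k+1)/k) ≥ 1/(k+1)` and `eˣ ≥ 1 + x`. -/
lemma sum_Ico_rpow_neg_le {c : ℝ} (hc : 1 < c) {K : ℕ} (hK : 1 ≤ K) (N : ℕ) :
    ∑ k ∈ Finset.Ico K N, ((k : ℝ) + 1) ^ (-c) ≤ (K : ℝ) ^ (1 - c) / (c - 1) := by
  have hc' : 0 < c - 1 := by linarith
  have step : ∀ k : ℕ, 1 ≤ k → ((k : ℝ) + 1) ^ (-c) ≤
      ((k : ℝ) ^ (1 - c) - ((k : ℝ) + 1) ^ (1 - c)) / (c - 1) := by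
    intro k hk
    have hk0 : (0 : ℝ) < k := by exact_mod_cast hk
    have h1 : (k : ℝ) ^ (1 - c) =
        ((k : ℝ) + 1) ^ (1 - c) * Real.exp ((c - 1) * Real.log (((k : ℝ) + 1) / k)) := by
      rw [Real.rpow_def_of_pos hk0, Real.rpow_def_of_pos (by positivity), ← Real.exp_add,
        Real.log_div (by positivity) (by positivity)]
      congr 1
      ring
    have h2 : 1 / ((k : ℝ) + 1) ≤ Real.log (((k : ℝ) + 1) / k) := by
      have := Real.one_sub_inv_le_log_of_pos (x := ((k : ℝ) + 1) / k) (by positivity)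
      refine le_trans (le_of_eq ?_) this
      field_simp
      ring
    have h3 : 1 + (c - 1) * (1 / ((k : ℝ) + 1)) ≤
        Real.exp ((c - 1) * Real.log (((k : ℝ) + 1) / k)) := by
      have := Real.add_one_le_exp ((c - 1) * Real.log (((k : ℝ) + 1) / k))
      nlinarith
    have h4 : ((k : ℝ) + 1) ^ (-c) = ((k : ℝ) + 1) ^ (1 - c) * (1 / ((k : ℝ) + 1)) := by
      rw [show -c = (1 - c) - 1 by ring, Real.rpow_sub_one (by positivity)]
      ring
    have h5 : 0 ≤ ((k : ℝ) + 1) ^ (1 - c) := by positivity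
    rw [le_div_iff₀ hc', h1, h4]
    nlinarith
  rcases le_total N K with hN | hN
  · rw [Finset.Ico_eq_empty_of_le hN, Finset.sum_empty]
    positivity
  · calc _ ≤ ∑ k ∈ Finset.Ico K N,
          ((k : ℝ) ^ (1 - c) - ((k : ℝ) + 1) ^ (1 - c)) / (c - 1) :=
        Finset.sum_le_sum fun k hk => step k (hK.trans (Finset.mem_Ico.1 hk).1)
      _ = ((K : ℝ) ^ (1 - c) - (N : ℝ) ^ (1 - c)) / (c - 1) := by
        rw [← Finset.sum_div]
        congr 1
        have := Finset.sum_Ico_sub (fun k : ℕ => -(k : ℝ) ^ (1 - c)) hN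
        refine (Finset.sum_congr rfl fun k _ => ?_).trans (this.trans (by ring))
        push_cast
        ring
      _ ≤ _ := by
        gcongr
        have : (0 : ℝ) ≤ (N : ℝ) ^ (1 - c) := by positivity
        linarith

/-- Factors at most 1 make the infinite product an infimum over finite sets. Since `a ≥ 0`, bounding
the sums over long initial segments suffices. -/
lemma ofReal_exp_neg_sum_le_infinitePi {H : Measure ℝ} [IsProbabilityMeasure H]
    {I : ℕ → Set ℝ} (hI : ∀ k, MeasurableSet (I k)) {a : ℕ → ℝ} (ha0 : ∀ k, 0 ≤ a k)
    (ha : ∀ k, ENNReal.ofReal (Real.exp (-a k)) ≤ H (I k)) {b : ℝ}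
    (hb : ∃ N₀, ∀ N ≥ N₀, ∑ k ∈ Finset.range N, a k ≤ b) :
    ENNReal.ofReal (Real.exp (-b)) ≤ Measure.infinitePi (fun _ : ℕ => H) (Set.univ.pi I) := by
  rw [Measure.infinitePi_pi_univ _ hI, ENNReal.tprod_eq_iInf_prod (fun _ => prob_le_one)]
  refine le_iInf fun s => ?_
  obtain ⟨N₀, hN₀⟩ := hb
  obtain ⟨N, hN⟩ := s.exists_nat_subset_range
  have h1 : ∑ k ∈ s, a k ≤ b :=
    (Finset.sum_le_sum_of_subset_of_nonneg (hN.trans (Finset.range_mono (le_max_left N N₀)))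
      fun k _ _ => ha0 k).trans (hN₀ _ (le_max_right N N₀))
  calc _ ≤ ENNReal.ofReal (Real.exp (∑ k ∈ s, -a k)) := by
        gcongr
        rw [Finset.sum_neg_distrib]
        linarith
    _ = ∏ k ∈ s, ENNReal.ofReal (Real.exp (-a k)) := by
        rw [Real.exp_sum, ENNReal.ofReal_prod_of_nonneg fun k _ => (Real.exp_pos _).le]
    _ ≤ _ := Finset.prod_le_prod' fun k _ => ha k

/-- A random series with absolutely summable scales and integrable coefficients has absolutely
summable coefficients almost surely. -/
lemma ae_summable_abs_mul {H : Measure ℝ} [IsProbabilityMeasure H]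
    (hH : ∫⁻ x, ENNReal.ofReal |x| ∂H ≠ ∞) {σ : ℕ → ℝ} (hσ : Summable fun k => |σ k|) :
    ∀ᵐ ζ ∂(Measure.infinitePi fun _ : ℕ => H), Summable fun k => |σ k * ζ k| := by
  have hm : ∀ k, Measurable fun ζ : ℕ → ℝ => ENNReal.ofReal |σ k * ζ k| := fun k => by
    have h1 : Measurable fun ζ : ℕ → ℝ => ζ k := measurable_pi_apply k
    exact (h1.const_mul (σ k)).abs.ennreal_ofReal
  have h : ∫⁻ ζ, ∑' k, ENNReal.ofReal |σ k * ζ k| ∂(Measure.infinitePi fun _ : ℕ => H) ≠ ∞ := by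
    rw [lintegral_tsum fun k => (hm k).aemeasurable]
    have e : ∀ k, ∫⁻ ζ, ENNReal.ofReal |σ k * ζ k| ∂(Measure.infinitePi fun _ : ℕ => H) =
        ENNReal.ofReal |σ k| * ∫⁻ x, ENNReal.ofReal |x| ∂H := fun k => by
      simp_rw [abs_mul, ENNReal.ofReal_mul (abs_nonneg _)]
      rw [lintegral_const_mul _ (measurable_pi_apply k).abs.ennreal_ofReal]
      congr 1
      exact (measurePreserving_eval_infinitePi (fun _ : ℕ => H) k).lintegral_comp
        measurable_abs.ennreal_ofReal
    simp_rw [e]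
    rw [ENNReal.tsum_mul_right]
    exact ENNReal.mul_ne_top hσ.tsum_ofReal_ne_top hH
  filter_upwards [ae_lt_top (Measurable.tsum hm) h] with ζ hζ
  have := ENNReal.summable_toReal hζ.ne
  simpa [ENNReal.toReal_ofReal (abs_nonneg _)] using this

lemma sum_Ico_sq_le_of_sobolev {β L : ℝ} (hβ : 0 < β) {c : ℕ → ℝ}
    (hc : Summable fun k : ℕ => ((k : ℝ) + 1) ^ (2 * β) * c k ^ 2)
    (hcL : ∑' k : ℕ, ((k : ℝ) + 1) ^ (2 * β) * c k ^ 2 ≤ L ^ 2) {K : ℕ} (hK : 1 ≤ K) (N : ℕ) :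
    ∑ k ∈ Finset.Ico K N, c k ^ 2 ≤ L ^ 2 * (K : ℝ) ^ (-(2 * β)) := by
  have hK0 : (0 : ℝ) < K := by exact_mod_cast hK
  rw [Real.rpow_neg hK0.le, ← div_eq_mul_inv, le_div_iff₀ (by positivity), Finset.sum_mul]
  calc _ ≤ ∑ k ∈ Finset.Ico K N, ((k : ℝ) + 1) ^ (2 * β) * c k ^ 2 := by
        refine Finset.sum_le_sum fun k hk => ?_
        have : (K : ℝ) ≤ k := by exact_mod_cast (Finset.mem_Ico.1 hk).1
        rw [mul_comm]
        gcongr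
        linarith
    _ ≤ ∑' k : ℕ, ((k : ℝ) + 1) ^ (2 * β) * c k ^ 2 :=
        hc.sum_le_tsum _ fun k _ => by positivity
    _ ≤ _ := hcL

/-- Lower bound for the prior mass of a neighbourhood of `c` in `ℓ²`, given lower bounds for the
mass that the first `K` coefficients put near those of `c`. -/
lemma exists_seriesPrior_ge {H : Measure ℝ} [IsProbabilityMeasure H] {h : ℝ → ℝ} {c₁ κ c₂ : ℝ}
    (hc₂ : 0 < c₂) (hH : IsHeavyTailed H h c₁ κ c₂) {σ : ℕ → ℝ} (hσ0 : ∀ k, 0 < σ k)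
    {A α β L : ℝ} (hA : 0 < A) (hα : 1 / 2 < α) (hβ : 0 < β) (hβα : β ≤ α)
    (hσ : ∀ k : ℕ, σ k ≤ A * ((k : ℝ) + 1) ^ (-(1 / 2) - α)) {c : ℕ → ℝ}
    (hc : Summable fun k : ℕ => ((k : ℝ) + 1) ^ (2 * β) * c k ^ 2)
    (hcL : ∑' k : ℕ, ((k : ℝ) + 1) ^ (2 * β) * c k ^ 2 ≤ L ^ 2) :
    ∃ D > 0, ∃ C₀ > 0, ∀ K : ℕ, 1 ≤ K → ∀ r C : ℝ, 0 < r → 0 ≤ C → (K : ℝ) ^ (-β) ≤ r →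
      (∀ k < K, ENNReal.ofReal (Real.exp (-C)) ≤ H {x | |σ k * x - c k| ≤ r / √K}) →
      ENNReal.ofReal (Real.exp (-((C + C₀) * K))) ≤ seriesPrior σ H
        {θ | (Summable fun k => |θ k|) ∧
          ∀ N, ∑ k ∈ Finset.range N, (θ k - c k) ^ 2 ≤ D * r ^ 2} := by
  -- The midpoint of `1/2` and `α`: `b > 1/2` makes the tail cost summable, with total of order `K`,
  -- while `b < α` makes the squared tail of the series summable, of order `K^{-2α}`.
  obtain ⟨b, hb⟩ : ∃ b, b = (α + 1 / 2) / 2 := ⟨_, rfl⟩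
  have hb1 : 1 < 2 * b := by linarith
  have hbα : 0 < 2 * α - 2 * b := by linarith
  obtain ⟨T, hT⟩ : ∃ T, T = √(4 * c₂ + 1) := ⟨_, rfl⟩
  have hT2 : T ^ 2 = 4 * c₂ + 1 := by rw [hT]; exact Real.sq_sqrt (by linarith)
  have hT1 : 1 ≤ T := by rw [hT]; exact Real.one_le_sqrt.2 (by linarith)
  refine ⟨1 + 2 * (A ^ 2 * T ^ 2 / (2 * α - 2 * b)) + 2 * L ^ 2, by positivity,
    4 * c₂ / T ^ 2 / (2 * b - 1), div_pos (by positivity) (by linarith), ?_⟩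
  intro K hK r C hr hC hKr hhead
  have hK0 : (0 : ℝ) < K := by exact_mod_cast hK
  -- Beyond `K` the variables may grow like `((k+1)/K)^b`. The choice `T² = 4c₂ + 1` makes
  -- `measure_abs_le_ge` applicable to all of them.
  set t : ℕ → ℝ := fun k => T * (((k : ℝ) + 1) / K) ^ b with ht
  set I : ℕ → Set ℝ := fun k =>
    if k < K then {x | |σ k * x - c k| ≤ r / √K} else {x | |x| ≤ t k} with hI
  set a : ℕ → ℝ := fun k =>
    if k < K then C else 4 * c₂ / T ^ 2 * (K : ℝ) ^ (2 * b) * ((k : ℝ) + 1) ^ (-(2 * b)) with ha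
  have htsq : ∀ k, t k ^ 2 = T ^ 2 * (((k : ℝ) + 1) ^ (2 * b) * (K : ℝ) ^ (-(2 * b))) := by
    intro k
    rw [ht, mul_pow, ← Real.rpow_mul_natCast (by positivity), Real.div_rpow (by positivity) hK0.le,
      Real.rpow_neg hK0.le, ← div_eq_mul_inv]
    push_cast
    rw [mul_comm b 2]
  have hIm : ∀ k, MeasurableSet (I k) := by
    intro k
    rw [hI]
    dsimp only
    split_ifs
    · exact measurableSet_le (by fun_prop) measurable_const
    · exact measurableSet_le measurable_abs measurable_const
  have ha0 : ∀ k, 0 ≤ a k := by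
    intro k
    rw [ha]
    dsimp only
    split_ifs
    · exact hC
    · positivity
  have hmass : ∀ k, ENNReal.ofReal (Real.exp (-a k)) ≤ H (I k) := by
    intro k
    by_cases hk : k < K
    · simp only [ha, hI, if_pos hk]
      exact hhead k hk
    · simp only [ha, hI, if_neg hk]
      have hkK : (K : ℝ) ≤ k := by exact_mod_cast not_lt.1 hk
      have hq : 1 ≤ (((k : ℝ) + 1) / K) ^ b := by
        refine Real.one_le_rpow ?_ (by linarith)
        rw [one_le_div hK0]
        linarith
      have htk : T ≤ t k := by
        rw [ht]; exact le_mul_of_one_le_right (by linarith) hq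
      have h4 : 4 * c₂ ≤ t k ^ 2 := by
        have : T ^ 2 ≤ t k ^ 2 := pow_le_pow_left₀ (by linarith) htk 2
        linarith
      refine le_trans (le_of_eq ?_) (hH.measure_abs_le_ge (hT1.trans htk) h4 hc₂)
      rw [htsq, Real.rpow_neg hK0.le, Real.rpow_neg (by positivity)]
      congr 3
      field_simp
  have hsum : ∀ N ≥ K, ∑ k ∈ Finset.range N, a k ≤ (C + 4 * c₂ / T ^ 2 / (2 * b - 1)) * K := by
    intro N hN
    rw [← Finset.sum_range_add_sum_Ico _ hN]
    have h1 : ∑ k ∈ Finset.range K, a k = C * K := by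
      rw [Finset.sum_congr rfl fun k hk => if_pos (Finset.mem_range.1 hk)]
      simp [mul_comm]
    have h2 : ∑ k ∈ Finset.Ico K N, a k ≤ 4 * c₂ / T ^ 2 / (2 * b - 1) * K := by
      rw [Finset.sum_congr rfl fun k hk => if_neg (not_lt.2 (Finset.mem_Ico.1 hk).1),
        ← Finset.mul_sum]
      calc _ ≤ 4 * c₂ / T ^ 2 * (K : ℝ) ^ (2 * b) * ((K : ℝ) ^ (1 - 2 * b) / (2 * b - 1)) := by
            gcongr
            exact sum_Ico_rpow_neg_le hb1 hK N
        _ = 4 * c₂ / T ^ 2 / (2 * b - 1) * ((K : ℝ) ^ (2 * b) * (K : ℝ) ^ (1 - 2 * b)) := by ring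
        _ = _ := by
            rw [← Real.rpow_add hK0]
            norm_num
    linarith
  have hprob := ofReal_exp_neg_sum_le_infinitePi hIm ha0 hmass ⟨K, hsum⟩
  -- Here `α > 1/2` is needed: with integrable `ζ_k` it makes the random coefficients absolutely
  -- summable almost surely.
  have hσs : Summable fun k => |σ k| := by
    have h1 : Summable fun k : ℕ => ((k : ℝ) + 1) ^ (-(1 / 2) - α) := by
      have := (summable_nat_add_iff 1).2 (Real.summable_nat_rpow (p := -(1 / 2) - α) |>.2
        (by linarith))
      simpa using this
    refine Summable.of_nonneg_of_le (fun k => abs_nonneg _) (fun k => ?_) (h1.mul_left A)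
    rw [abs_of_pos (hσ0 k)]
    exact hσ k
  have hae := ae_summable_abs_mul hH.lintegral_abs_ne_top hσs
  refine hprob.trans ?_
  have hmeas : Measurable fun (ζ : ℕ → ℝ) (k : ℕ) => σ k * ζ k :=
    measurable_pi_lambda _ fun k => (measurable_pi_apply k).const_mul _
  refine le_trans ?_ (Measure.le_map_apply hmeas.aemeasurable _)
  refine measure_mono_ae ?_
  filter_upwards [hae] with ζ hζ hζI
  refine ⟨hζ, fun N => ?_⟩
  have hζI' : ∀ k, ζ k ∈ I k := fun k => hζI k (Set.mem_univ k)
  have hhd : ∑ k ∈ Finset.range K, (σ k * ζ k - c k) ^ 2 ≤ r ^ 2 := by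
    calc _ ≤ ∑ k ∈ Finset.range K, (r / √K) ^ 2 := by
          refine Finset.sum_le_sum fun k hk => ?_
          have := hζI' k
          simp only [hI, if_pos (Finset.mem_range.1 hk)] at this
          exact sq_le_sq' (abs_le.1 this).1 (abs_le.1 this).2
      _ = r ^ 2 := by
          rw [Finset.sum_const, Finset.card_range, nsmul_eq_mul, div_pow, Real.sq_sqrt hK0.le]
          field_simp
  have hK2β : (K : ℝ) ^ (-(2 * β)) ≤ r ^ 2 := by
    have : (K : ℝ) ^ (-(2 * β)) = ((K : ℝ) ^ (-β)) ^ 2 := by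
      rw [← Real.rpow_mul_natCast hK0.le]
      congr 1
      push_cast
      ring
    rw [this]
    exact pow_le_pow_left₀ (by positivity) hKr 2
  -- Here `β ≤ α` enters: the prior tail is no larger than the bias of a truth of smoothness `β`.
  have hK2α : (K : ℝ) ^ (-(2 * α)) ≤ r ^ 2 := by
    refine le_trans (Real.rpow_le_rpow_of_exponent_le ?_ (by linarith)) hK2β
    exact_mod_cast hK
  have htail : ∑ k ∈ Finset.Ico K N, (σ k * ζ k - c k) ^ 2 ≤
      2 * (A ^ 2 * T ^ 2 / (2 * α - 2 * b) * (K : ℝ) ^ (-(2 * α))) +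
        2 * (L ^ 2 * (K : ℝ) ^ (-(2 * β))) := by
    have h1 : ∑ k ∈ Finset.Ico K N, (σ k * ζ k) ^ 2 ≤
        A ^ 2 * T ^ 2 / (2 * α - 2 * b) * (K : ℝ) ^ (-(2 * α)) := by
      calc _ ≤ ∑ k ∈ Finset.Ico K N, A ^ 2 * T ^ 2 * (K : ℝ) ^ (-(2 * b)) *
            ((k : ℝ) + 1) ^ (-(1 + 2 * α - 2 * b)) := by
            refine Finset.sum_le_sum fun k hk => ?_
            have hz := hζI' k
            simp only [hI, if_neg (not_lt.2 (Finset.mem_Ico.1 hk).1)] at hz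
            have hk0 : (0 : ℝ) < (k : ℝ) + 1 := by positivity
            have hz2 : ζ k ^ 2 ≤ t k ^ 2 := sq_le_sq' (abs_le.1 hz).1 (abs_le.1 hz).2
            have hs2 : σ k ^ 2 ≤ (A * ((k : ℝ) + 1) ^ (-(1 / 2) - α)) ^ 2 :=
              pow_le_pow_left₀ (hσ0 k).le (hσ k) 2
            rw [mul_pow]
            calc _ ≤ (A * ((k : ℝ) + 1) ^ (-(1 / 2) - α)) ^ 2 * t k ^ 2 := by gcongr
              _ = A ^ 2 * T ^ 2 * (K : ℝ) ^ (-(2 * b)) *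
                  (((k : ℝ) + 1) ^ (-1 - 2 * α) * ((k : ℝ) + 1) ^ (2 * b)) := by
                  rw [htsq, mul_pow, ← Real.rpow_mul_natCast hk0.le]
                  push_cast
                  rw [show (-(1 / 2) - α) * 2 = -1 - 2 * α by ring]
                  ring
              _ = _ := by
                  rw [← Real.rpow_add hk0]
                  congr 2
                  ring
        _ ≤ A ^ 2 * T ^ 2 * (K : ℝ) ^ (-(2 * b)) *
            ((K : ℝ) ^ (1 - (1 + 2 * α - 2 * b)) / (1 + 2 * α - 2 * b - 1)) := by
            rw [← Finset.mul_sum]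
            gcongr
            exact sum_Ico_rpow_neg_le (by linarith) hK N
        _ = A ^ 2 * T ^ 2 / (2 * α - 2 * b) *
            ((K : ℝ) ^ (-(2 * b)) * (K : ℝ) ^ (1 - (1 + 2 * α - 2 * b))) := by
            rw [show 1 + 2 * α - 2 * b - 1 = 2 * α - 2 * b by ring]
            ring
        _ = _ := by
            rw [← Real.rpow_add hK0]
            congr 2
            ring
    have h2 := sum_Ico_sq_le_of_sobolev hβ hc hcL hK N
    calc _ ≤ ∑ k ∈ Finset.Ico K N, (2 * (σ k * ζ k) ^ 2 + 2 * c k ^ 2) :=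
          Finset.sum_le_sum fun k _ => by nlinarith [sq_nonneg (σ k * ζ k + c k)]
      _ = 2 * ∑ k ∈ Finset.Ico K N, (σ k * ζ k) ^ 2 + 2 * ∑ k ∈ Finset.Ico K N, c k ^ 2 := by
          rw [Finset.sum_add_distrib, Finset.mul_sum, Finset.mul_sum]
      _ ≤ _ := by linarith
  have htail' : ∑ k ∈ Finset.Ico K N, (σ k * ζ k - c k) ^ 2 ≤
      2 * (A ^ 2 * T ^ 2 / (2 * α - 2 * b) * r ^ 2) + 2 * (L ^ 2 * r ^ 2) := by
    refine htail.trans ?_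
    gcongr
  change ∑ k ∈ Finset.range N, (σ k * ζ k - c k) ^ 2 ≤ _
  have hsplit : ∑ k ∈ Finset.range N, (σ k * ζ k - c k) ^ 2 ≤
      ∑ k ∈ Finset.range K, (σ k * ζ k - c k) ^ 2 +
        ∑ k ∈ Finset.Ico K N, (σ k * ζ k - c k) ^ 2 := by
    rcases le_total K N with hKN | hKN
    · rw [Finset.sum_range_add_sum_Ico _ hKN]
    · rw [Finset.Ico_eq_empty_of_le hKN, Finset.sum_empty, add_zero]
      exact Finset.sum_le_sum_of_subset_of_nonneg (Finset.range_mono hKN)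
        fun k _ _ => sq_nonneg _
  calc _ ≤ r ^ 2 + (2 * (A ^ 2 * T ^ 2 / (2 * α - 2 * b) * r ^ 2) + 2 * (L ^ 2 * r ^ 2)) := by
        linarith
    _ = _ := by ring

/-! ### Contraction of the tempered posterior -/

section Contraction

variable {d : ℕ} (φ : HilbertBasis ℕ ℝ (L2Cube d)) {g : Cube d → ℝ}

lemma lintegral_designLaw_le (hg : Measurable g) {Cg : ℝ} (hCg : ∀ᵐ x, g x ≤ Cg)
    {F : Cube d → ℝ≥0∞} (hF : Measurable F) :
    ∫⁻ x, F x ∂(designLaw g) ≤ ENNReal.ofReal Cg * ∫⁻ x, F x := by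
  rw [designLaw, lintegral_withDensity_eq_lintegral_mul _ hg.ennreal_ofReal hF,
    ← lintegral_const_mul _ hF]
  refine lintegral_mono_ae ?_
  filter_upwards [hCg] with x hx
  rw [Pi.mul_apply]
  gcongr

lemma measurable_distG1 [SFinite (designLaw g)] {f₀ : Cube d → ℝ} (hf₀ : Measurable f₀) :
    Measurable fun θ => distG1 g (seriesFun φ θ) f₀ := by
  have h : Measurable fun p : (ℕ → ℝ) × Cube d =>
      ∑ y : Fin 2, |labelProb (seriesFun φ p.1) (p.2, y) - labelProb f₀ (p.2, y)| := by
    refine Finset.measurable_sum _ fun y _ => ?_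
    have h1 := measurable_labelProb_uncurry (measurable_seriesFun_uncurry φ)
    have h2 : Measurable fun p : (ℕ → ℝ) × Cube d => (p.1, (p.2, y)) := by fun_prop
    have h3 := h1.comp h2
    have h4 : Measurable fun p : (ℕ → ℝ) × Cube d => (p.2, y) := by fun_prop
    have h5 := (measurable_labelProb hf₀).comp h4
    exact (h3.sub h5).abs
  exact (h.stronglyMeasurable.integral_prod_right').measurable

instance instIsProbabilityMeasureSeriesPrior (σ : ℕ → ℝ) (H : Measure ℝ)
    [IsProbabilityMeasure H] : IsProbabilityMeasure (seriesPrior σ H) :=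
  Measure.isProbabilityMeasure_map (measurable_pi_lambda _ fun k =>
    (measurable_pi_apply k).const_mul _).aemeasurable

lemma expectedPosterior_le (hg : Measurable g) (hg0 : ∀ x, 0 ≤ g x) (hg1 : ∫ x, g x = 1)
    {Cg : ℝ} (hCg0 : 0 < Cg) (hCg : ∀ᵐ x, g x ≤ Cg) (σ : ℕ → ℝ) (H : Measure ℝ)
    [IsProbabilityMeasure H] (f₀ : L2Cube d) {ρ : ℝ} (h0 : 0 < ρ) (h1 : ρ < 1) {n : ℕ}
    (hn : 0 < n) {r v a : ℝ} (hr : 0 ≤ r) (hv : 0 < v)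
    (hprior : ENNReal.ofReal (Real.exp (-a)) ≤ seriesPrior σ H
      {θ | (Summable fun k => |θ k|) ∧
        ∀ N, ∑ k ∈ Finset.range N, (θ k - inner ℝ f₀ (φ k)) ^ 2 ≤ v}) :
    expectedPosterior φ σ H g f₀ ρ n r ≤ ENNReal.ofReal (2 / (n * (Cg * v)) +
      2 * Real.exp (-(n * (min ρ (1 - ρ) / 8 * r ^ 2)) + 2 * ρ * (n * (Cg * v)) + a)) := by
  have := isProbabilityMeasure_designLaw hg0 hg1
  have hf₀ : Measurable f₀ := (Lp.stronglyMeasurable f₀).measurable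
  have := isProbabilityMeasure_obsLaw hg hg0 hf₀
  have hF := measurable_seriesFun_uncurry φ
  set V := Cg * v with hV
  have hV0 : 0 < V := mul_pos hCg0 hv
  have hn' : (0 : ℝ) < n := by exact_mod_cast hn
  set R : (ℕ → ℝ) → (Fin n → Cube d × Fin 2) → ℝ≥0∞ :=
    fun θ z => ∏ i, temperedRatio ρ (seriesFun φ θ) f₀ (z i) with hR
  have hRm : Measurable (Function.uncurry R) := by
    refine Finset.measurable_prod _ fun i _ => ?_
    have h2 := measurable_temperedRatio_uncurry hF hf₀ ρ
    have h3 : Measurable fun p : (ℕ → ℝ) × (Fin n → Cube d × Fin 2) => (p.1, p.2 i) := by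
      fun_prop
    have h4 := h2.comp h3
    exact h4
  set U : Set (ℕ → ℝ) := {θ | distG1 g (seriesFun φ θ) f₀ > r}
  have hU : MeasurableSet U := measurableSet_lt measurable_const (measurable_distG1 φ hf₀)
  have hsq : Measurable fun p : (ℕ → ℝ) × Cube d =>
      ENNReal.ofReal ((seriesFun φ p.1 p.2 - f₀ p.2) ^ 2) :=
    ((hF.sub (hf₀.comp measurable_snd)).pow_const 2).ennreal_ofReal
  -- The set `B` is a ball in `L²(G)`; the coefficient neighbourhood of `hprior` is contained in it
  -- by Parseval and the bound on `g`, and only this inclusion is used.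
  set B : Set (ℕ → ℝ) :=
    {θ | ∫⁻ x, ENNReal.ofReal ((seriesFun φ θ x - f₀ x) ^ 2) ∂(designLaw g) ≤ ENNReal.ofReal V}
  have hB : MeasurableSet B :=
    measurableSet_le (Measurable.lintegral_prod_right' hsq) measurable_const
  have hBmass : ENNReal.ofReal (Real.exp (-a)) ≤ seriesPrior σ H B := by
    refine hprior.trans (measure_mono fun θ hθ => ?_)
    have hs : Measurable fun x => ENNReal.ofReal ((seriesFun φ θ x - f₀ x) ^ 2) :=
      (((measurable_seriesFun φ θ).sub hf₀).pow_const 2).ennreal_ofReal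
    refine (lintegral_designLaw_le hg hCg hs).trans ?_
    rw [hV, ENNReal.ofReal_mul hCg0.le]
    gcongr
    exact lintegral_sq_seriesFun_sub_le φ hθ.1 f₀ hθ.2
  have hexp : 0 < ENNReal.ofReal (Real.exp (-a)) := ENNReal.ofReal_pos.2 (Real.exp_pos _)
  set u : ℝ := Real.exp (-(n * (min ρ (1 - ρ) / 8 * r ^ 2))) with hu
  set t : ℝ := Real.exp (-(2 * ρ * (n * V))) with ht
  have hm : 0 ≤ min ρ (1 - ρ) := le_min h0.le (by linarith)
  have key := lintegral_div_lintegral_le (seriesPrior σ H)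
    (Measure.pi fun _ : Fin n => obsLaw g f₀) R hRm U B hU hB (ENNReal.ofReal u)
    (ENNReal.ofReal t) (ENNReal.ofReal (1 / (n * V))) (hexp.trans_le hBmass).ne' ?_ ?_
  · calc expectedPosterior φ σ H g f₀ ρ n r
        = ∫⁻ z, (∫⁻ θ in U, R θ z ∂(seriesPrior σ H)) / (∫⁻ θ, R θ z ∂(seriesPrior σ H))
            ∂(Measure.pi fun _ : Fin n => obsLaw g f₀) := by
          refine lintegral_congr_ae ?_
          filter_upwards [ae_pi_obsLaw_pos hg hg0 hf₀ n] with z hz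
          exact temperedPosterior_obsDensity _ hF hf₀ ρ z hz _
      _ ≤ _ := key
      _ ≤ 2 * ENNReal.ofReal (1 / (n * V)) + 2 * ENNReal.ofReal u * 1 /
            (ENNReal.ofReal t * ENNReal.ofReal (Real.exp (-a))) := by
          gcongr
          exact prob_le_one
      _ = _ := by
          rw [mul_one, ← ENNReal.ofReal_mul (Real.exp_pos _).le,
            show (2 : ℝ≥0∞) = ENNReal.ofReal 2 by simp, ← ENNReal.ofReal_mul two_pos.le,
            ← ENNReal.ofReal_mul two_pos.le, ← ENNReal.ofReal_div_of_pos (by positivity),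
            ← ENNReal.ofReal_add (by positivity) (by positivity)]
          congr 2
          · ring
          · rw [hu]
            rw [← Real.exp_add, mul_div_assoc, ← Real.exp_sub]
            congr 2
            ring
  · intro θ hθ
    have hθ' : r < distG1 g (seriesFun φ θ) f₀ := hθ
    have hfm := measurable_seriesFun φ θ
    simp only [hR]
    rw [lintegral_pi_prod _ (measurable_temperedRatio hfm hf₀ ρ), Fintype.card_fin]
    refine (pow_le_pow_left₀ zero_le
      (lintegral_temperedRatio_le hg hg0 h0 h1 hfm hf₀) n).trans ?_
    rw [← ENNReal.ofReal_pow (Real.exp_pos _).le, ← Real.exp_nat_mul]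
    refine ENNReal.ofReal_le_ofReal (Real.exp_le_exp.2 ?_)
    rw [mul_neg, neg_le_neg_iff]
    gcongr
  · intro θ hθ
    exact measure_prod_temperedRatio_lt_le hg hg0 h0 hV0 (measurable_seriesFun φ θ) hf₀ hθ hn

/-- Each of the leading coefficients puts mass of logarithmically small exponential order near
the corresponding coefficient of the truth. -/
lemma exists_measure_abs_mul_sub_le_ge {H : Measure ℝ} {h : ℝ → ℝ} {c₁ κ c₂ : ℝ} (hc₁ : 0 < c₁)
    (hκ : 0 ≤ κ) (hH : IsHeavyTailed H h c₁ κ c₂) {σ : ℕ → ℝ} {A b q L : ℝ}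
    (hA : 0 < A) (hb : 0 < b) (hq : 1 ≤ q) (hL : 0 < L) (hσ0 : ∀ k, 0 < σ k)
    (hσA : ∀ k, σ k ≤ A)
    (hσ : ∀ k : ℕ, Real.exp (-(b * (1 + Real.log ((k : ℝ) + 1)) ^ q)) ≤ σ k) {c : ℕ → ℝ}
    (hc : ∀ k, |c k| ≤ L) :
    ∃ C > 0, ∀ n : ℕ, 3 ≤ n → ∀ K : ℕ, 1 ≤ K → K ≤ 2 * n → ∀ r : ℝ, 0 < r → 1 / (n : ℝ) ≤ r ^ 2 →
      ∀ k < K, ENNReal.ofReal (Real.exp (-(C * Real.log n ^ (q * (1 + κ))))) ≤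
        H {x | |σ k * x - c k| ≤ r / √K} := by
  set G := Real.log (2 + L) + b * 3 ^ q with hG
  have hlogL : 0 < Real.log (2 + L) := Real.log_pos (by linarith)
  have hlogA : 0 < Real.log (2 * (A + 1)) := Real.log_pos (by linarith)
  have hG0 : 0 < G := by positivity
  refine ⟨1 + Real.log (2 * (A + 1)) + c₁ + c₁ * G ^ (1 + κ), by positivity, ?_⟩
  intro n hn K hK hKn r hr hrn k hk
  have hn' : (3 : ℝ) ≤ n := by exact_mod_cast hn
  have hK0 : (0 : ℝ) < K := by exact_mod_cast hK
  set l := Real.log n with hl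
  have hl1 : 1 ≤ l := by
    rw [hl, Real.le_log_iff_exp_le (by linarith)]
    linarith [Real.exp_one_lt_d9]
  set s := q * (1 + κ) with hs
  have hs1 : 1 ≤ s := by nlinarith
  have hls : l ≤ l ^ s := by
    conv_lhs => rw [← Real.rpow_one l]
    exact Real.rpow_le_rpow_of_exponent_le hl1 hs1
  have hlq : 1 ≤ l ^ q := Real.one_le_rpow hl1 (by linarith)
  -- With `σ_k ≤ A` this window moves the coefficient by at most `1/(2n)`, which is below `r/√K`
  -- because `r² ≥ 1/n` and `K ≤ 2n`. Using `A + 1` also ensures `w ≤ 1`.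
  set w : ℝ := 1 / (2 * (A + 1) * n) with hw
  have hw0 : 0 < w := by positivity
  have hw1 : w ≤ 1 := by
    rw [hw, div_le_one (by positivity)]
    nlinarith
  have hwexp : w = Real.exp (-(l + Real.log (2 * (A + 1)))) := by
    rw [hw, Real.exp_neg, Real.exp_add, hl, Real.exp_log (by linarith),
      Real.exp_log (by linarith), one_div, mul_comm (n : ℝ)]
  set x₀ := c k / σ k with hx₀
  have hsub : {x : ℝ | |x - x₀| ≤ w} ⊆ {x | |σ k * x - c k| ≤ r / √K} := by
    intro x hx
    rw [Set.mem_ofPred_eq] at hx ⊢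
    have e : σ k * x - c k = σ k * (x - x₀) := by
      rw [hx₀]
      field_simp [(hσ0 k).ne']
    rw [e, abs_mul, abs_of_pos (hσ0 k)]
    have h1 : σ k * |x - x₀| ≤ 1 / (2 * n) := by
      calc _ ≤ A * w := mul_le_mul (hσA k) hx (abs_nonneg _) hA.le
        _ ≤ (A + 1) * w := by gcongr; linarith
        _ = _ := by rw [hw]; field_simp
    refine h1.trans ?_
    refine le_of_sq_le_sq ?_ (by positivity)
    rw [div_pow, div_pow, Real.sq_sqrt hK0.le]
    have h2 : (K : ℝ) ≤ 2 * n := by exact_mod_cast hKn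
    calc _ = 1 / (n : ℝ) / (4 * n) := by field_simp; norm_num
      _ ≤ r ^ 2 / (4 * n) := by gcongr
      _ ≤ r ^ 2 / K := by gcongr; linarith
  refine le_trans ?_ (measure_mono hsub)
  refine le_trans (ENNReal.ofReal_le_ofReal ?_) (hH.measure_abs_sub_le_ge x₀ hw0.le hw1)
  have hE : 2 + |x₀| ≤ (2 + L) * Real.exp (b * 3 ^ q * l ^ q) := by
    have hk2 : (k : ℝ) + 1 ≤ 2 * n := by
      have : k + 1 ≤ 2 * n := by omega
      exact_mod_cast this
    have hlog : 1 + Real.log ((k : ℝ) + 1) ≤ 3 * l := by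
      have h1 : Real.log ((k : ℝ) + 1) ≤ Real.log (2 * n) :=
        Real.log_le_log (by positivity) hk2
      have h2 : Real.log (2 * n) = Real.log 2 + l := Real.log_mul (by norm_num) (by linarith)
      have h3 : Real.log 2 ≤ l := Real.log_le_log (by norm_num) (by linarith)
      linarith
    have hlog0 : 0 ≤ 1 + Real.log ((k : ℝ) + 1) := by
      have := Real.log_nonneg (x := (k : ℝ) + 1) (by simp)
      linarith
    have hpow : (1 + Real.log ((k : ℝ) + 1)) ^ q ≤ 3 ^ q * l ^ q := by
      rw [← Real.mul_rpow (by norm_num) (by linarith)]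
      exact Real.rpow_le_rpow hlog0 hlog (by linarith)
    have hinv : 1 / σ k ≤ Real.exp (b * 3 ^ q * l ^ q) := by
      rw [div_le_iff₀ (hσ0 k)]
      calc (1 : ℝ) = Real.exp (b * 3 ^ q * l ^ q) * Real.exp (-(b * 3 ^ q * l ^ q)) := by
            rw [← Real.exp_add]; simp
        _ ≤ Real.exp (b * 3 ^ q * l ^ q) * σ k := by
            gcongr
            refine le_trans (Real.exp_le_exp.2 ?_) (hσ k)
            rw [neg_le_neg_iff, mul_assoc]
            gcongr
    have hexp1 : 1 ≤ Real.exp (b * 3 ^ q * l ^ q) := Real.one_le_exp (by positivity)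
    have hx : |x₀| ≤ L * Real.exp (b * 3 ^ q * l ^ q) := by
      rw [hx₀, abs_div, abs_of_pos (hσ0 k), div_eq_mul_one_div]
      exact mul_le_mul (hc k) hinv (by have := hσ0 k; positivity) hL.le
    nlinarith
  have hlogx : Real.log (1 + (|x₀| + 1)) ≤ G * l ^ q := by
    rw [show 1 + (|x₀| + 1) = 2 + |x₀| by ring]
    refine (Real.log_le_log (by positivity) hE).trans ?_
    rw [Real.log_mul (by linarith) (Real.exp_pos _).ne', Real.log_exp, hG]
    nlinarith
  have hlogx0 : 0 ≤ Real.log (1 + (|x₀| + 1)) :=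
    Real.log_nonneg (by linarith [abs_nonneg x₀])
  have hpow : Real.log (1 + (|x₀| + 1)) ^ (1 + κ) ≤ G ^ (1 + κ) * l ^ s := by
    rw [hs, Real.rpow_mul (by linarith), ← Real.mul_rpow hG0.le (by positivity)]
    exact Real.rpow_le_rpow hlogx0 hlogx (by linarith)
  have hh := hH.log_inv_le (|x₀| + 1) (by positivity)
  have hpos := hH.positive (|x₀| + 1)
  rw [one_div, Real.log_inv] at hh
  have hhexp : h (|x₀| + 1) = Real.exp (Real.log (h (|x₀| + 1))) := (Real.exp_log hpos).symm
  rw [hwexp, hhexp, ← Real.exp_add, Real.exp_le_exp]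
  have h1 : c₁ * (1 + Real.log (1 + (|x₀| + 1)) ^ (1 + κ)) ≤ c₁ * (l ^ s + G ^ (1 + κ) * l ^ s) := by
    gcongr
    linarith
  have h2 : Real.log (2 * (A + 1)) ≤ Real.log (2 * (A + 1)) * l ^ s :=
    le_mul_of_one_le_right hlogA.le (by linarith)
  linarith

end Contraction

/-! ### Choice of cutoff, the general contraction theorem and the two families of scales -/

lemma abs_inner_le_of_mem_sobolevBall {d : ℕ} {φ : HilbertBasis ℕ ℝ (L2Cube d)} {β L : ℝ}
    (hβ : 0 < β) (hL : 0 < L) {f₀ : L2Cube d} (hf₀ : f₀ ∈ sobolevBall φ β L) (k : ℕ) :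
    |inner ℝ f₀ (φ k)| ≤ L := by
  refine abs_le_of_sq_le_sq ?_ hL.le
  have h1 : (1 : ℝ) ≤ ((k : ℝ) + 1) ^ (2 * β) := Real.one_le_rpow (by simp) (by linarith)
  calc inner ℝ f₀ (φ k) ^ 2 ≤ ((k : ℝ) + 1) ^ (2 * β) * inner ℝ f₀ (φ k) ^ 2 :=
        le_mul_of_one_le_left (sq_nonneg _) h1
    _ ≤ ∑' k : ℕ, ((k : ℝ) + 1) ^ (2 * β) * (inner ℝ f₀ (φ k)) ^ 2 :=
        hf₀.1.le_tsum k fun j _ => by positivity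
    _ ≤ _ := hf₀.2

/-- The effective dimension `⌈r^{-1/β}⌉` attached to the rate `r = (log n)^p n^{-β/(2β+1)}`. -/
lemma exists_cutoff {β p s : ℝ} (hβ : 0 < β) (hs : 0 ≤ s) (hp : s * β / (2 * β + 1) ≤ p) {n : ℕ}
    (hn : 3 ≤ n) (hlog : Real.log n ^ s ≤ (n : ℝ) ^ (1 / (2 * β + 1))) {r : ℝ}
    (hr : r = Real.log n ^ p * (n : ℝ) ^ (-(β / (2 * β + 1)))) :
    0 < r ∧ 1 / (n : ℝ) ≤ r ^ 2 ∧ (n : ℝ) ^ (1 / (2 * β + 1)) ≤ n * r ^ 2 ∧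
      ∃ K : ℕ, 1 ≤ K ∧ K ≤ 2 * n ∧ (K : ℝ) ^ (-β) ≤ r ∧
        Real.log n ^ s * K ≤ 2 * (n * r ^ 2) := by
  have hn' : (3 : ℝ) ≤ n := by exact_mod_cast hn
  have hn0 : (0 : ℝ) < n := by linarith
  have hβ' : 0 < 2 * β + 1 := by linarith
  have hp0 : 0 ≤ p := le_trans (by positivity) hp
  set l := Real.log n with hl
  have hl1 : 1 ≤ l := by
    rw [hl, Real.le_log_iff_exp_le hn0]
    linarith [Real.exp_one_lt_d9]
  have hl0 : 0 < l := by linarith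
  have hr0 : 0 < r := by rw [hr]; positivity
  have hr2 : r ^ 2 = l ^ (2 * p) * (n : ℝ) ^ (-(2 * β / (2 * β + 1))) := by
    rw [hr, mul_pow, ← Real.rpow_mul_natCast hl0.le, ← Real.rpow_mul_natCast hn0.le]
    push_cast
    congr 2 <;> ring
  have hlp : 1 ≤ l ^ (2 * p) := Real.one_le_rpow hl1 (by linarith)
  have hnr : n * r ^ 2 = l ^ (2 * p) * (n : ℝ) ^ (1 / (2 * β + 1)) := by
    rw [hr2, mul_left_comm]
    congr 1
    conv_lhs => rw [← Real.rpow_one (n : ℝ), ← Real.rpow_mul hn0.le, ← Real.rpow_add hn0]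
    congr 1
    field_simp
    ring
  have hnr1 : (n : ℝ) ^ (1 / (2 * β + 1)) ≤ n * r ^ 2 := by
    rw [hnr]
    exact le_mul_of_one_le_left (by positivity) hlp
  have hn1 : 1 ≤ (n : ℝ) ^ (1 / (2 * β + 1)) := Real.one_le_rpow (by linarith) (by positivity)
  refine ⟨hr0, ?_, hnr1, ?_⟩
  · rw [div_le_iff₀ hn0, mul_comm]
    exact hn1.trans hnr1
  have hrβ : r ^ (-(1 / β)) = l ^ (-(p / β)) * (n : ℝ) ^ (1 / (2 * β + 1)) := by
    rw [hr, Real.mul_rpow (by positivity) (by positivity), ← Real.rpow_mul hl0.le,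
      ← Real.rpow_mul hn0.le]
    congr 2
    · ring
    · field_simp
  have hrβ0 : 0 < r ^ (-(1 / β)) := by positivity
  refine ⟨⌈r ^ (-(1 / β))⌉₊, Nat.one_le_ceil_iff.2 hrβ0, ?_, ?_, ?_⟩
  · refine Nat.ceil_le.2 ?_
    have h1 : l ^ (-(p / β)) ≤ 1 :=
      Real.rpow_le_one_of_one_le_of_nonpos hl1 (by rw [neg_nonpos]; positivity)
    have h2 : (n : ℝ) ^ (1 / (2 * β + 1)) ≤ n := by
      conv_rhs => rw [← Real.rpow_one (n : ℝ)]
      refine Real.rpow_le_rpow_of_exponent_le (by linarith) ?_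
      rw [div_le_one hβ']
      linarith
    rw [hrβ]
    push_cast
    calc _ ≤ (n : ℝ) ^ (1 / (2 * β + 1)) := mul_le_of_le_one_left (by positivity) h1
      _ ≤ 2 * n := by linarith
  · calc _ ≤ (r ^ (-(1 / β))) ^ (-β) :=
          Real.rpow_le_rpow_of_nonpos hrβ0 (Nat.le_ceil _) (by linarith)
      _ = r := by
          rw [← Real.rpow_mul hr0.le]
          have : -(1 / β) * -β = 1 := by field_simp
          rw [this, Real.rpow_one]
  · have h1 : (⌈r ^ (-(1 / β))⌉₊ : ℝ) ≤ r ^ (-(1 / β)) + 1 := (Nat.ceil_lt_add_one hrβ0.le).le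
    -- This is where the exponent of the logarithm is decided: `s ≤ 2p + p/β` is exactly `p ≥
    -- sβ/(2β+1)`. The 1 lost to the ceiling is absorbed by `hlog`.
    have h2 : l ^ s * r ^ (-(1 / β)) ≤ n * r ^ 2 := by
      rw [hrβ, hnr, ← mul_assoc, ← Real.rpow_add hl0]
      gcongr
      rw [div_le_iff₀ hβ'] at hp
      have : s ≤ p * (2 * β + 1) / β := by rwa [le_div_iff₀ hβ]
      have e : p * (2 * β + 1) / β = 2 * p + p / β := by field_simp
      linarith
    calc _ ≤ l ^ s * (r ^ (-(1 / β)) + 1) := by gcongr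
      _ ≤ _ := by linarith

lemma eventually_log_rpow_le (s : ℝ) {e : ℝ} (he : 0 < e) :
    ∀ᶠ n : ℕ in atTop, Real.log n ^ s ≤ (n : ℝ) ^ e := by
  have h := ((isLittleO_log_rpow_rpow_atTop s he).comp_tendsto
    tendsto_natCast_atTop_atTop).bound one_pos
  filter_upwards [h, eventually_ge_atTop 1] with n hn hn1
  have hn0 : (0 : ℝ) ≤ Real.log n := Real.log_natCast_nonneg n
  simp only [Function.comp_apply, one_mul] at hn
  rwa [Real.norm_of_nonneg (by positivity), Real.norm_of_nonneg (by positivity)] at hn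

/-- Contraction of the tempered posterior for scales decaying at least polynomially and not too
fast. -/
theorem tendsto_expectedPosterior {d : ℕ} (φ : HilbertBasis ℕ ℝ (L2Cube d))
    {g : Cube d → ℝ} (hg_meas : Measurable g) (hg_nonneg : ∀ x, 0 ≤ g x)
    (hg_int : ∫ x, g x = 1) (hg_bdd : ∃ C : ℝ, ∀ᵐ x, g x ≤ C)
    {H : Measure ℝ} [IsProbabilityMeasure H] {h : ℝ → ℝ} {c₁ κ c₂ : ℝ}
    (hc₁ : 0 < c₁) (hκ : 0 ≤ κ) (hc₂ : 0 < c₂) (hH : IsHeavyTailed H h c₁ κ c₂)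
    {β L : ℝ} (hβ : 0 < β) (hL : 0 < L) {f₀ : L2Cube d} (hf₀ : f₀ ∈ sobolevBall φ β L)
    {σ : ℕ → ℝ} {A α b q p : ℝ} (hA : 0 < A) (hα : 1 / 2 < α) (hβα : β ≤ α) (hb : 0 < b)
    (hq : 1 ≤ q) (hp : q * (1 + κ) * β / (2 * β + 1) ≤ p)
    (hσA : ∀ k : ℕ, σ k ≤ A * ((k : ℝ) + 1) ^ (-(1 / 2) - α))
    (hσb : ∀ k : ℕ, Real.exp (-(b * (1 + Real.log ((k : ℝ) + 1)) ^ q)) ≤ σ k)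
    {ρ : ℝ} (h0 : 0 < ρ) (h1 : ρ < 1) :
    ∃ M : ℝ, 0 < M ∧ Tendsto (fun n : ℕ => expectedPosterior φ σ H g f₀ ρ n
      (M * (Real.log n ^ p * (n : ℝ) ^ (-(β / (2 * β + 1)))))) atTop (𝓝 0) := by
  have hσ0 : ∀ k, 0 < σ k := fun k => (Real.exp_pos _).trans_le (hσb k)
  have hσA' : ∀ k, σ k ≤ A := fun k => (hσA k).trans <| mul_le_of_le_one_right hA.le <|
    Real.rpow_le_one_of_one_le_of_nonpos (by simp) (by linarith)
  obtain ⟨Cg, hCg0, hCg⟩ : ∃ Cg > 0, ∀ᵐ x, g x ≤ Cg := by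
    obtain ⟨C, hC⟩ := hg_bdd
    exact ⟨max C 1, by positivity, hC.mono fun x hx => hx.trans (le_max_left _ _)⟩
  obtain ⟨D, hD, C₀, hC₀, hprior⟩ := exists_seriesPrior_ge hc₂ hH hσ0 hA hα hβ hβα hσA hf₀.1 hf₀.2
  obtain ⟨C, hC, hhead⟩ := exists_measure_abs_mul_sub_le_ge hc₁ hκ hH hA hb hq hL hσ0 hσA' hσb
    (abs_inner_le_of_mem_sobolevBall hβ hL hf₀)
  have hs0 : 0 ≤ q * (1 + κ) := by positivity
  have hβ' : 0 < 2 * β + 1 := by linarith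
  set m := min ρ (1 - ρ) / 8 with hm
  have hm0 : 0 < m := div_pos (lt_min h0 (by linarith)) (by norm_num)
  -- `E` pays for the evidence bound and the prior mass and leaves 1, so the final exponent is at
  -- most `-n r² ≤ -n^{1/(2β+1)}`.
  set E := 2 * ρ * (Cg * D) + 2 * (C + C₀) + 1 with hE
  have hE0 : 0 < E := by positivity
  refine ⟨√(E / m), by positivity, ?_⟩
  have hM2 : m * √(E / m) ^ 2 = E := by
    rw [Real.sq_sqrt (by positivity)]
    field_simp
  set e := 1 / (2 * β + 1) with he
  have he0 : 0 < e := by positivity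
  have hpow : Tendsto (fun n : ℕ => (n : ℝ) ^ e) atTop atTop :=
    (tendsto_rpow_atTop he0).comp tendsto_natCast_atTop_atTop
  have hlim : Tendsto (fun n : ℕ => ENNReal.ofReal
      (2 / (Cg * D) * ((n : ℝ) ^ e)⁻¹ + 2 * Real.exp (-(n : ℝ) ^ e))) atTop (𝓝 0) := by
    rw [← ENNReal.ofReal_zero]
    refine (ENNReal.continuous_ofReal.tendsto _).comp ?_
    have h2 := (hpow.inv_tendsto_atTop.const_mul (2 / (Cg * D))).add
      ((Real.tendsto_exp_neg_atTop_nhds_zero.comp hpow).const_mul 2)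
    simpa using h2
  refine tendsto_of_tendsto_of_tendsto_of_le_of_le' tendsto_const_nhds hlim
    (Eventually.of_forall fun _ => zero_le) ?_
  filter_upwards [eventually_log_rpow_le (q * (1 + κ)) he0, eventually_ge_atTop 3] with n hlog hn
  obtain ⟨r, hr⟩ : ∃ r, r = Real.log n ^ p * (n : ℝ) ^ (-(β / (2 * β + 1))) := ⟨_, rfl⟩
  obtain ⟨hr0, hr1, hnr, K, hK1, hK2, hKr, hKlog⟩ := exists_cutoff hβ hs0 hp hn hlog hr
  rw [← hr]
  have hn' : (3 : ℝ) ≤ n := by exact_mod_cast hn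
  have hl1 : 1 ≤ Real.log n := by
    rw [Real.le_log_iff_exp_le (by linarith)]
    linarith [Real.exp_one_lt_d9]
  have hls : 1 ≤ Real.log n ^ (q * (1 + κ)) := Real.one_le_rpow hl1 hs0
  have hmass := hprior K hK1 r (C * Real.log n ^ (q * (1 + κ))) hr0 (by positivity) hKr
    (hhead n hn K hK1 hK2 r hr0 hr1)
  refine (expectedPosterior_le φ hg_meas hg_nonneg hg_int hCg0 hCg σ H f₀ h0 h1 (by omega)
    (r := √(E / m) * r) (by positivity) (by positivity) hmass).trans ?_
  have hne : 0 < (n : ℝ) ^ e := by positivity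
  have hcost : (C * Real.log n ^ (q * (1 + κ)) + C₀) * K ≤ 2 * (C + C₀) * (n * r ^ 2) := by
    calc _ ≤ (C * Real.log n ^ (q * (1 + κ)) + C₀ * Real.log n ^ (q * (1 + κ))) * K := by
          gcongr
          exact le_mul_of_one_le_right hC₀.le hls
      _ = (C + C₀) * (Real.log n ^ (q * (1 + κ)) * K) := by ring
      _ ≤ (C + C₀) * (2 * (n * r ^ 2)) := by gcongr
      _ = _ := by ring
  have hexp : -(n * (m * (√(E / m) * r) ^ 2)) + 2 * ρ * (n * (Cg * (D * r ^ 2))) +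
      (C * Real.log n ^ (q * (1 + κ)) + C₀) * K ≤ -(n : ℝ) ^ e := by
    have h3 : n * (m * (√(E / m) * r) ^ 2) = E * (n * r ^ 2) := by
      calc _ = m * √(E / m) ^ 2 * (n * r ^ 2) := by ring
        _ = _ := by rw [hM2]
    rw [h3, hE]
    linarith
  refine ENNReal.ofReal_le_ofReal (add_le_add ?_ ?_)
  · calc 2 / (n * (Cg * (D * r ^ 2))) = 2 / (Cg * D) * (n * r ^ 2)⁻¹ := by
          field_simp
      _ ≤ _ := by gcongr
  · gcongr

/-- The scale `exp(-a (log k)^{1+δ})` decays faster than any power of `k`. -/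
lemma exists_fastScale_le {a δ : ℝ} (ha : 0 < a) (hδ : 0 < δ) (γ : ℝ) (hγ : 0 < γ) :
    ∃ A > 0, ∀ k : ℕ, fastScale a δ k ≤ A * ((k : ℝ) + 1) ^ (-γ) := by
  -- Past this value of `log(k+1)` one has `a y^δ ≥ γ`; below it the constant `exp(γ y₀)` suffices.
  set y₀ := (γ / a) ^ (1 / δ) with hy₀
  have hy₀0 : 0 < y₀ := by positivity
  refine ⟨Real.exp (γ * y₀), Real.exp_pos _, fun k => ?_⟩
  have hk : (0 : ℝ) < (k : ℝ) + 1 := by positivity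
  set y := Real.log ((k : ℝ) + 1) with hy
  have hy0 : 0 ≤ y := Real.log_nonneg (by simp)
  rw [fastScale, Real.rpow_def_of_pos hk, ← Real.exp_add, Real.exp_le_exp, ← hy]
  rcases le_total y y₀ with hle | hle
  · have h1 : 0 ≤ a * y ^ (1 + δ) := by positivity
    nlinarith
  · have hypos : 0 < y := hy₀0.trans_le hle
    have h1 : γ / a ≤ y ^ δ := by
      calc γ / a = y₀ ^ δ := by
            rw [hy₀, ← Real.rpow_mul (by positivity)]
            have : 1 / δ * δ = 1 := by field_simp
            rw [this, Real.rpow_one]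
        _ ≤ y ^ δ := Real.rpow_le_rpow hy₀0.le hle hδ.le
    have h2 : γ ≤ a * y ^ δ := by
      rw [div_le_iff₀ ha] at h1
      linarith
    have h3 : y ^ (1 + δ) = y * y ^ δ := by rw [Real.rpow_add hypos, Real.rpow_one]
    have h4 : γ * y ≤ a * y ^ δ * y := by gcongr
    have h5 : 0 < γ * y₀ := by positivity
    rw [h3]
    nlinarith

lemma le_fastScale {a δ : ℝ} (ha : 0 < a) (hδ : 0 < δ) (k : ℕ) :
    Real.exp (-(a * (1 + Real.log ((k : ℝ) + 1)) ^ (1 + δ))) ≤ fastScale a δ k := by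
  have hy0 : 0 ≤ Real.log ((k : ℝ) + 1) := Real.log_nonneg (by simp)
  rw [fastScale, Real.exp_le_exp, neg_mul, neg_le_neg_iff]
  gcongr
  linarith

lemma le_polyScale {α : ℝ} (hα : 0 < α) (k : ℕ) :
    Real.exp (-((1 / 2 + α) * (1 + Real.log ((k : ℝ) + 1)) ^ (1 : ℝ))) ≤ polyScale α k := by
  have hk : (0 : ℝ) < (k : ℝ) + 1 := by positivity
  rw [polyScale, Real.rpow_def_of_pos hk, Real.exp_le_exp, Real.rpow_one]
  nlinarith

theorem theorem9
    {d : ℕ} (hd : 1 ≤ d)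
    (φ : HilbertBasis ℕ ℝ (L2Cube d))
    (g : Cube d → ℝ) (hg_meas : Measurable g) (hg_nonneg : ∀ x, 0 ≤ g x)
    (hg_int : ∫ x, g x = 1) (hg_bdd : ∃ C : ℝ, ∀ᵐ x, g x ≤ C)
    (H : Measure ℝ) [IsProbabilityMeasure H] (h : ℝ → ℝ) (c₁ κ c₂ : ℝ)
    (hc₁ : 0 < c₁) (hκ : 0 ≤ κ) (hc₂ : 0 < c₂) (hH : IsHeavyTailed H h c₁ κ c₂)
    (β L : ℝ) (hβ : 0 < β) (hL : 0 < L)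
    (f₀ : L2Cube d) (hf₀ : f₀ ∈ sobolevBall φ β L) :
    (∀ α : ℝ, 1 / 2 < α → β ≤ α →
      ∀ ρ : ℝ, 0 < ρ → ρ < 1 → ∃ M : ℝ, 0 < M ∧
        Tendsto (fun n : ℕ =>
          expectedPosterior φ (polyScale α) H g f₀ ρ n (M * polyRate κ β n)) atTop (𝓝 0)) ∧
    (∀ a δ : ℝ, 0 < a → 0 < δ →
      ∀ ρ : ℝ, 0 < ρ → ρ < 1 → ∃ M : ℝ, 0 < M ∧
        Tendsto (fun n : ℕ =>
          expectedPosterior φ (fastScale a δ) H g f₀ ρ n (M * fastRate κ δ β n)) atTop (𝓝 0)) := by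
  refine ⟨fun α hα hβα ρ h0 h1 => ?_, fun a δ ha hδ ρ h0 h1 => ?_⟩
  · refine tendsto_expectedPosterior φ hg_meas hg_nonneg hg_int hg_bdd hc₁ hκ hc₂ hH hβ hL hf₀
      (σ := polyScale α) (A := 1) (b := 1 / 2 + α) (q := 1) one_pos hα hβα (by linarith) le_rfl ?_
      (fun k => by rw [one_mul, polyScale]) (le_polyScale (by linarith)) h0 h1
    -- With `q = 1` the argument needs only `(1+κ)β/(2β+1)`; the additional 1 in the numerator for
    -- polynomial scales is slack.
    gcongr
    linarith
  · obtain ⟨A, hA, hσA⟩ := exists_fastScale_le ha hδ (1 / 2 + max β 1) (by positivity)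
    refine tendsto_expectedPosterior φ hg_meas hg_nonneg hg_int hg_bdd hc₁ hκ hc₂ hH hβ hL hf₀
      (σ := fastScale a δ) (q := 1 + δ) hA
      (lt_of_lt_of_le (by norm_num) (le_max_right β 1)) (le_max_left β 1) ha (by linarith)
      (le_of_eq ?_) (fun k => ?_) (le_fastScale ha hδ) h0 h1
    · ring
    · refine (hσA k).trans (le_of_eq ?_)
      congr 2
      ring
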